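/- Let $m_1,m_2\ge 0$ be integers, $m=m_1+m_2$, and let $\mathcal S_m^{\pm}(m_1,m_2)$ be the set of real symmetric $m\times m$ matrices with $m_1$ distinct positive eigenvalues $\lambda_1>\dots>\lambda_{m_1}>0$ and $m_2$ distinct negative eigenvalues $0>-\delta_1>\dots>-\delta_{m_2}$ (such matrices are nonsingular, and indefinite when $m_1,m_2\ge 1$). Write $\mathbf A=\mathbf H\mathbf D\mathbf H'$ with $\mathbf H=(h_1,\dots,h_m)\in\mathcal O(m)$ and $\mathbf D=\mathrm{diag}(\lambda_1,\dots,\lambda_{m_1},-\delta_1,\dots,-\delta_{m_2})$. Let $(d\mathbf A)=\bigwedge_{i\le j}da_{ij}$ be Lebesgue measure on the symmetric $m\times m$ matrices, let $(\mathbf H'd\mathbf H)=\bigwedge_{i<j}h_j'dh_i$ be the (unnormalized) invariant measure on $\mathcal O(m)$ defined by this exterior product taken without sign, and let $(d\mathbf D)=\bigwedge_{i=1}^{m_1}d\lambda_i\bigwedge_{j=1}^{m_2}d\delta_j$ be Lebesgue measure on the set of parameters $(\lambda,\delta)$ with $\lambda_1>\dots>\lambda_{m_1}>0>-\delta_1>\dots>-\delta_{m_2}$.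 Then $$(d\mathbf A)=2^{-m}\,\Bigl|\prod_{1\le i<j\le m_1}(\lambda_i-\lambda_j)\prod_{1\le i<j\le m_2}(\delta_i-\delta_j)\prod_{i=1}^{m_1}\prod_{j=1}^{m_2}(\lambda_i+\delta_j)\Bigr|\,(\mathbf H'd\mathbf H)\wedge(d\mathbf D),$$ as an identity of measures: the restriction of $(d\mathbf A)$ to $\mathcal S_m^{\pm}(m_1,m_2)$ is the image, under $(\mathbf H,\mathbf D)\mapsto\mathbf H\mathbf D\mathbf H'$, of the measure on the right-hand side, with $\mathbf H$ running over the whole of $\mathcal O(m)$. -/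

import Mathlib

open MeasureTheory
open scoped ENNReal

/-- The Borel σ-algebra (equivalently, the product σ-algebra of the entries) on matrices. -/
instance matrixMeasurableSpace (m : ℕ) : MeasurableSpace (Matrix (Fin m) (Fin m) ℝ) :=
  MeasurableSpace.pi

instance matrixBorelSpace (m : ℕ) : BorelSpace (Matrix (Fin m) (Fin m) ℝ) :=
  inferInstanceAs (BorelSpace (Fin m → Fin m → ℝ))

/-- Index set of the pairs `i < j`; there are `m (m - 1) / 2` of them, the dimension of `O(m)`. -/
abbrev StrictPairs (m : ℕ) : Type := {p : Fin m × Fin m // p.1 < p.2}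

/-- Index set of the pairs `i ≤ j`: the free entries of a symmetric `m × m` matrix. -/
abbrev WeakPairs (m : ℕ) : Type := {p : Fin m × Fin m // p.1 ≤ p.2}

/-- The symmetric matrix with prescribed entries `a i j` for `i ≤ j`. -/
def symmOfUpper {m : ℕ} (a : WeakPairs m → ℝ) : Matrix (Fin m) (Fin m) ℝ :=
  Matrix.of fun i j => a ⟨(min i j, max i j), min_le_max⟩

/-- The measure `(dA) = ⋀_{i ≤ j} da_{ij}`: Lebesgue measure on the space of symmetric
`m × m` matrices in the coordinates `a_{ij}`, `i ≤ j`, seen as a measure on all `m × m` matrices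
that is carried by the symmetric ones. -/
noncomputable def symmLebesgue (m : ℕ) : Measure (Matrix (Fin m) (Fin m) ℝ) :=
  (volume : Measure (WeakPairs m → ℝ)).map symmOfUpper

/-- A `C¹` injective parametrization of a piece of `O(m)` by an open subset of a coordinate
space of dimension `m (m - 1) / 2`. -/
structure OrthParam (m : ℕ) where
  /-- the open domain of the parameters -/
  dom : Set (StrictPairs m → ℝ)
  /-- the parametrization; only its values on `dom` matter -/
  toFun : (StrictPairs m → ℝ) → Matrix.orthogonalGroup (Fin m) ℝ
  isOpen_dom : IsOpen dom
  injOn : Set.InjOn toFun dom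
  contDiffOn : ∀ a i : Fin m,
    ContDiffOn ℝ 1 (fun u => (toFun u : Matrix (Fin m) (Fin m) ℝ) a i) dom

/-- The one-forms `h_j' dh_i` (`i < j`), pulled back to the parameters `u`, as the matrix of their
values `h_j' ∂h_i/∂u_k` on the coordinate vectors; `h_i` is the `i`-th column of `H`. -/
noncomputable def OrthParam.formMatrix {m : ℕ} (c : OrthParam m) (u : StrictPairs m → ℝ) :
    Matrix (StrictPairs m) (StrictPairs m) ℝ :=
  Matrix.of fun p k => ∑ a : Fin m,
    (c.toFun u : Matrix (Fin m) (Fin m) ℝ) a p.1.2 *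
      fderiv ℝ (fun v => (c.toFun v : Matrix (Fin m) (Fin m) ℝ) a p.1.1) u (Pi.single k 1)

/-- The measure on the image of a parametrization that is given by the (unsigned) exterior product
`⋀_{i < j} h_j' dh_i`: the pulled-back form has the determinant of `formMatrix` as its coefficient
with respect to `du`. -/
noncomputable def OrthParam.measure {m : ℕ} (c : OrthParam m) :
    Measure (Matrix.orthogonalGroup (Fin m) ℝ) :=
  ((volume.restrict c.dom).withDensity
    (fun u => ENNReal.ofReal |(c.formMatrix u).det|)).map c.toFun

/-- The invariant measure `(H'dH) = ⋀_{i < j} h_j' dh_i` on the whole of `O(m)` (not normalized to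
a probability measure). On the image of each regular parametrization it is the measure given
there by the form; those local measures agree on overlaps, so it is their supremum. -/
noncomputable def orthFormMeasure (m : ℕ) : Measure (Matrix.orthogonalGroup (Fin m) ℝ) :=
  ⨆ c : OrthParam m, c.measure

/-- The real symmetric matrices of size `m₁ + m₂` with `m₁` distinct positive and `m₂` distinct
negative eigenvalues. (All eigenvalues are then simple and nonzero.) -/
def symmIndef (m₁ m₂ : ℕ) : Set (Matrix (Fin (m₁ + m₂)) (Fin (m₁ + m₂)) ℝ) :=
  {A | A.IsSymm ∧
    {x : ℝ | 0 < x ∧ Module.End.HasEigenvalue (Matrix.toLin' A) x}.ncard = m₁ ∧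
    {x : ℝ | x < 0 ∧ Module.End.HasEigenvalue (Matrix.toLin' A) x}.ncard = m₂}

/-- The parameters `(l, d)` with `l₁ > ⋯ > l_{m₁} > 0` and `0 > -d₁ > ⋯ > -d_{m₂}`. -/
def eigenDomain (m₁ m₂ : ℕ) : Set ((Fin m₁ → ℝ) × (Fin m₂ → ℝ)) :=
  {p | (StrictAnti p.1 ∧ ∀ i, 0 < p.1 i) ∧
    (StrictAnti (fun j => -p.2 j) ∧ ∀ j, -p.2 j < 0)}

/-- The diagonal matrix `D = diag(l₁, …, l_{m₁}, -d₁, …, -d_{m₂})`. -/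
def eigenDiag {m₁ m₂ : ℕ} (p : (Fin m₁ → ℝ) × (Fin m₂ → ℝ)) :
    Matrix (Fin (m₁ + m₂)) (Fin (m₁ + m₂)) ℝ :=
  Matrix.diagonal (Fin.append p.1 (fun j => -p.2 j))

/-- The measure `(dD) = dl₁ ⋯ dl_{m₁} dd₁ ⋯ dd_{m₂}` on the admissible parameters. -/
noncomputable def eigenMeasure (m₁ m₂ : ℕ) : Measure ((Fin m₁ → ℝ) × (Fin m₂ → ℝ)) :=
  (volume : Measure ((Fin m₁ → ℝ) × (Fin m₂ → ℝ))).restrict (eigenDomain m₁ m₂)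

/-- `∏_{i<j} (l_i - l_j) ∏_{i<j} (d_i - d_j) ∏_{i,j} (l_i + d_j)`, with its sign. -/
noncomputable def eigenJacobian {m₁ m₂ : ℕ} (p : (Fin m₁ → ℝ) × (Fin m₂ → ℝ)) : ℝ :=
  (∏ i, ∏ j ∈ Finset.Ioi i, (p.1 i - p.1 j)) *
    (∏ i, ∏ j ∈ Finset.Ioi i, (p.2 i - p.2 j)) *
    ∏ i, ∏ j, (p.1 i + p.2 j)

/-- The map `(H, D) ↦ H D H'`. -/
noncomputable def spectralMap {m₁ m₂ : ℕ}
    (q : Matrix.orthogonalGroup (Fin (m₁ + m₂)) ℝ × ((Fin m₁ → ℝ) × (Fin m₂ → ℝ))) :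
    Matrix (Fin (m₁ + m₂)) (Fin (m₁ + m₂)) ℝ :=
  (q.1 : Matrix (Fin (m₁ + m₂)) (Fin (m₁ + m₂)) ℝ) * eigenDiag q.2 *
    (q.1 : Matrix (Fin (m₁ + m₂)) (Fin (m₁ + m₂)) ℝ).transpose

@[to_additive]
lemma prod_strictPairs {M : Type*} [CommMonoid M] {m : ℕ} (g : Fin m → Fin m → M) :
    ∏ p : StrictPairs m, g p.1.1 p.1.2 = ∏ i, ∏ j, if i < j then g i j else 1 := by
  rw [← Fintype.prod_prod_type' (f := fun i j => if i < j then g i j else 1),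
    ← Finset.prod_filter]
  exact (Finset.prod_subtype (Finset.univ.filter fun p : Fin m × Fin m => p.1 < p.2)
    (by simp) (fun p : Fin m × Fin m => g p.1 p.2)).symm

lemma sum_sum_eq_strictPairs {m : ℕ} (f : Fin m → Fin m → ℝ) :
    ∑ i, ∑ j, f i j = ∑ p : StrictPairs m, (f p.1.1 p.1.2 + f p.1.2 p.1.1) + ∑ i, f i i := by
  rw [Finset.sum_add_distrib, sum_strictPairs f, sum_strictPairs fun i j => f j i,
    Finset.sum_comm (f := fun i j => if i < j then f j i else 0), ← Finset.sum_add_distrib,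
    ← Finset.sum_add_distrib]
  refine Finset.sum_congr rfl fun i _ => ?_
  have : f i i = ∑ j, if j = i then f i j else 0 := by simp
  rw [this, ← Finset.sum_add_distrib, ← Finset.sum_add_distrib]
  refine Finset.sum_congr rfl fun j _ => ?_
  rcases lt_trichotomy i j with h | h | h
  · simp [h, h.ne', h.not_gt]
  · simp [h]
  · simp [h, h.ne, h.not_gt]

/-- Coordinates of a symmetric matrix: the entries above the diagonal and those on it. -/
abbrev SymmCoord (m : ℕ) : Type := StrictPairs m ⊕ Fin m

/-- The symmetric matrix with given coordinates. -/
def symmOfCoord (m : ℕ) : (SymmCoord m → ℝ) →ₗ[ℝ] Matrix (Fin m) (Fin m) ℝ where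
  toFun z := Matrix.of fun i j =>
    if h : i < j then z (.inl ⟨(i, j), h⟩) else
      if h : j < i then z (.inl ⟨(j, i), h⟩) else z (.inr i)
  map_add' z w := by ext i j; simp only [Matrix.of_apply, Matrix.add_apply]; split_ifs <;> rfl
  map_smul' r z := by ext i j; simp only [Matrix.of_apply, Matrix.smul_apply]; split_ifs <;> rfl

/-- The coordinates of a symmetric matrix. -/
def coordOfMatrix (m : ℕ) : Matrix (Fin m) (Fin m) ℝ →ₗ[ℝ] (SymmCoord m → ℝ) where
  toFun A := Sum.elim (fun p => A p.1.1 p.1.2) (fun i => A i i)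
  map_add' A B := by ext (p | i) <;> rfl
  map_smul' r A := by ext (p | i) <;> rfl

lemma symmOfCoord_of_lt {m : ℕ} (z : SymmCoord m → ℝ) (p : StrictPairs m) :
    symmOfCoord m z p.1.1 p.1.2 = z (.inl p) := by
  simp [symmOfCoord, p.2]

lemma symmOfCoord_of_gt {m : ℕ} (z : SymmCoord m → ℝ) (p : StrictPairs m) :
    symmOfCoord m z p.1.2 p.1.1 = z (.inl p) := by
  simp [symmOfCoord, p.2, p.2.not_gt]

lemma symmOfCoord_diag {m : ℕ} (z : SymmCoord m → ℝ) (i : Fin m) :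
    symmOfCoord m z i i = z (.inr i) := by
  simp [symmOfCoord]

lemma coordOfMatrix_symmOfCoord {m : ℕ} (z : SymmCoord m → ℝ) :
    coordOfMatrix m (symmOfCoord m z) = z := by
  ext (p | i)
  · exact symmOfCoord_of_lt z p
  · exact symmOfCoord_diag z i

lemma isSymm_symmOfCoord {m : ℕ} (z : SymmCoord m → ℝ) : (symmOfCoord m z).IsSymm := by
  refine Matrix.IsSymm.ext fun i j => ?_
  rcases lt_trichotomy i j with h | rfl | h
  · exact (symmOfCoord_of_gt z ⟨(i, j), h⟩).trans (symmOfCoord_of_lt z ⟨(i, j), h⟩).symm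
  · rfl
  · exact (symmOfCoord_of_lt z ⟨(j, i), h⟩).trans (symmOfCoord_of_gt z ⟨(j, i), h⟩).symm

lemma symmOfCoord_coordOfMatrix {m : ℕ} {A : Matrix (Fin m) (Fin m) ℝ} (hA : A.IsSymm) :
    symmOfCoord m (coordOfMatrix m A) = A := by
  ext i j
  rcases lt_trichotomy i j with h | rfl | h
  · exact symmOfCoord_of_lt _ ⟨(i, j), h⟩
  · exact symmOfCoord_diag _ _
  · exact (symmOfCoord_of_gt _ ⟨(j, i), h⟩).trans (hA.apply i j)

lemma trace_symmOfCoord_mul {m : ℕ} (z w : SymmCoord m → ℝ) :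
    (symmOfCoord m z * symmOfCoord m w).trace =
      z ⬝ᵥ (Matrix.diagonal (Sum.elim (fun _ => 2) (fun _ => 1)) : Matrix _ _ ℝ).mulVec w := by
  simp only [Matrix.trace, Matrix.diag, Matrix.mul_apply]
  rw [sum_sum_eq_strictPairs]
  simp only [symmOfCoord_of_lt, symmOfCoord_of_gt, symmOfCoord_diag, dotProduct,
    Matrix.mulVec_diagonal, Fintype.sum_sum_type, Sum.elim_inl, Sum.elim_inr]
  congr 1 <;> exact Finset.sum_congr rfl fun _ _ => by ring

/-- Conjugation by `H` on the symmetric matrices, in coordinates. -/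
def conjCoord {m : ℕ} (H : Matrix (Fin m) (Fin m) ℝ) :
    (SymmCoord m → ℝ) →ₗ[ℝ] (SymmCoord m → ℝ) :=
  coordOfMatrix m ∘ₗ LinearMap.mulRight ℝ H.transpose ∘ₗ LinearMap.mulLeft ℝ H ∘ₗ symmOfCoord m

lemma conjCoord_apply {m : ℕ} (H : Matrix (Fin m) (Fin m) ℝ) (z : SymmCoord m → ℝ) :
    conjCoord H z = coordOfMatrix m (H * symmOfCoord m z * H.transpose) := rfl

lemma symmOfCoord_conjCoord {m : ℕ} (H : Matrix (Fin m) (Fin m) ℝ) (z : SymmCoord m → ℝ) :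
    symmOfCoord m (conjCoord H z) = H * symmOfCoord m z * H.transpose := by
  rw [conjCoord_apply, symmOfCoord_coordOfMatrix]
  have h := isSymm_symmOfCoord z
  rw [Matrix.IsSymm] at h ⊢
  simp [Matrix.transpose_mul, h, Matrix.mul_assoc]

lemma abs_det_conjCoord {m : ℕ} {H : Matrix (Fin m) (Fin m) ℝ} (hH : H.transpose * H = 1) :
    |LinearMap.det (conjCoord H)| = 1 := by
  set Q : Matrix (SymmCoord m) (SymmCoord m) ℝ :=
    Matrix.diagonal (Sum.elim (fun _ => 2) (fun _ => 1)) with hQ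
  set L := LinearMap.toMatrix' (conjCoord H) with hL
  have key : L.transpose * Q * L = Q := by
    suffices h : ∀ z w, z ⬝ᵥ (L.transpose * Q * L).mulVec w = z ⬝ᵥ Q.mulVec w by
      ext i j
      simpa [Matrix.mulVec_single_one] using h (Pi.single i 1) (Pi.single j 1)
    intro z w
    have e (v) : L.mulVec v = conjCoord H v := by
      rw [hL, LinearMap.toMatrix'_mulVec]
    rw [← Matrix.mulVec_mulVec,
      ← Matrix.mulVec_mulVec, Matrix.dotProduct_mulVec, Matrix.vecMul_transpose, e, e,
      ← trace_symmOfCoord_mul, ← trace_symmOfCoord_mul, symmOfCoord_conjCoord,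
      symmOfCoord_conjCoord]
    calc _ = (H * (symmOfCoord m z * (H.transpose * H) * symmOfCoord m w * H.transpose)).trace := by
          simp only [Matrix.mul_assoc]
      _ = (symmOfCoord m z * symmOfCoord m w * (H.transpose * H)).trace := by
          rw [hH, Matrix.trace_mul_comm]; simp only [Matrix.mul_assoc, Matrix.mul_one, hH]
      _ = _ := by rw [hH, Matrix.mul_one]
  have hd := congrArg Matrix.det key
  have hQ0 : Q.det ≠ 0 := by
    rw [hQ, Matrix.det_diagonal, Fintype.prod_sum_type]; simp
  rw [Matrix.det_mul, Matrix.det_mul, Matrix.det_transpose] at hd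
  have h1 : L.det * L.det = 1 := by
    have : Q.det * (L.det * L.det - 1) = 0 := by linear_combination hd
    rcases mul_eq_zero.1 this with h | h
    · exact absurd h hQ0
    · linarith
  rw [← LinearMap.det_toMatrix', ← hL]
  rcases mul_self_eq_one_iff.1 h1 with h | h <;> simp [h]

/-- The Vandermonde product `∏_{i < j} (x_i - x_j)`. -/
def gapProd {m : ℕ} (x : Fin m → ℝ) : ℝ := ∏ p : StrictPairs m, (x p.1.1 - x p.1.2)

/-- The matrix `H diag(x) H'`. -/
def conjDiag {m : ℕ} (q : Matrix.orthogonalGroup (Fin m) ℝ × (Fin m → ℝ)) :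
    Matrix (Fin m) (Fin m) ℝ :=
  (q.1 : Matrix (Fin m) (Fin m) ℝ) * Matrix.diagonal q.2 *
    (q.1 : Matrix (Fin m) (Fin m) ℝ).transpose

lemma isSymm_conjDiag {m : ℕ} (q : Matrix.orthogonalGroup (Fin m) ℝ × (Fin m → ℝ)) :
    (conjDiag q).IsSymm := by
  simp [Matrix.IsSymm, conjDiag, Matrix.transpose_mul, Matrix.mul_assoc]

lemma mul_diagonal_mul_transpose_apply {m : ℕ} (A B : Matrix (Fin m) (Fin m) ℝ) (x : Fin m → ℝ)
    (a b : Fin m) :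
    (A * Matrix.diagonal x * B.transpose) a b = ∑ k, A a k * x k * B b k := by
  rw [Matrix.mul_apply]
  simp [Matrix.mul_diagonal]

lemma conjDiag_apply {m : ℕ} (q : Matrix.orthogonalGroup (Fin m) ℝ × (Fin m → ℝ)) (a b : Fin m) :
    conjDiag q a b = ∑ k, (q.1 : Matrix (Fin m) (Fin m) ℝ) a k * q.2 k *
      (q.1 : Matrix (Fin m) (Fin m) ℝ) b k := by
  exact mul_diagonal_mul_transpose_apply _ _ _ _ _

lemma orthogonal_transpose_mul {m : ℕ} (H : Matrix.orthogonalGroup (Fin m) ℝ) :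
    (H : Matrix (Fin m) (Fin m) ℝ).transpose * (H : Matrix (Fin m) (Fin m) ℝ) = 1 :=
  (Matrix.mem_orthogonalGroup_iff' (Fin m) ℝ).1 H.2

lemma orthogonal_mul_transpose {m : ℕ} (H : Matrix.orthogonalGroup (Fin m) ℝ) :
    (H : Matrix (Fin m) (Fin m) ℝ) * (H : Matrix (Fin m) (Fin m) ℝ).transpose = 1 :=
  (Matrix.mem_orthogonalGroup_iff (Fin m) ℝ).1 H.2

lemma conj_commutator_eq {m : ℕ} {H V : Matrix (Fin m) (Fin m) ℝ} (hH : H * H.transpose = 1)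
    (hV : (H.transpose * V).transpose = -(H.transpose * V)) (D E : Matrix (Fin m) (Fin m) ℝ) :
    H * (H.transpose * V * D - D * (H.transpose * V) + E) * H.transpose =
      V * D * H.transpose + H * D * V.transpose + H * E * H.transpose := by
  have h1 : H.transpose * V = -(V.transpose * H) := by
    rw [← neg_eq_iff_eq_neg, ← hV, Matrix.transpose_mul, Matrix.transpose_transpose]
  have h2 : H * (D * (H.transpose * V)) * H.transpose = -(H * D * V.transpose) := by
    rw [h1]; simp [Matrix.mul_assoc, hH]
  have h3 : H * (H.transpose * V * D) * H.transpose = V * D * H.transpose := by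
    simp only [← Matrix.mul_assoc, hH, Matrix.one_mul]
  rw [Matrix.mul_add, Matrix.mul_sub, Matrix.add_mul, Matrix.sub_mul, h2, h3, sub_neg_eq_add]

namespace OrthParam

variable {m : ℕ} (c : OrthParam m)

/-- The map `(u, x) ↦ c(u) diag(x) c(u)'` between coordinate spaces. -/
def coordMap (z : SymmCoord m → ℝ) : SymmCoord m → ℝ :=
  coordOfMatrix m (conjDiag (c.toFun (fun p => z (.inl p)), fun i => z (.inr i)))

/-- The derivative of `(u, x) ↦ c(u) diag(x) c(u)'`, conjugated back by `c(u)`. -/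
noncomputable def frameDeriv (z : SymmCoord m → ℝ) : Matrix (SymmCoord m) (SymmCoord m) ℝ :=
  Matrix.fromBlocks
    (Matrix.diagonal (fun p : StrictPairs m => z (.inr p.1.1) - z (.inr p.1.2)) *
      c.formMatrix (fun p => z (.inl p))) 0 0 1

lemma det_frameDeriv (z : SymmCoord m → ℝ) :
    (c.frameDeriv z).det =
      gapProd (fun i => z (.inr i)) * (c.formMatrix (fun p => z (.inl p))).det := by
  simp [frameDeriv, gapProd]

/-- The derivative of `(u, x) ↦ c(u) diag(x) c(u)'`. -/
noncomputable def coordDeriv (z : SymmCoord m → ℝ) : (SymmCoord m → ℝ) →L[ℝ] (SymmCoord m → ℝ) :=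
  LinearMap.toContinuousLinearMap
    (conjCoord (c.toFun (fun p => z (.inl p)) : Matrix (Fin m) (Fin m) ℝ) ∘ₗ
      Matrix.toLin' (c.frameDeriv z))

lemma coordDeriv_apply (z v : SymmCoord m → ℝ) :
    c.coordDeriv z v =
      conjCoord (c.toFun (fun p => z (.inl p)) : Matrix (Fin m) (Fin m) ℝ)
        ((c.frameDeriv z).mulVec v) := by
  rw [coordDeriv, LinearMap.coe_toContinuousLinearMap', LinearMap.comp_apply, Matrix.toLin'_apply]

lemma abs_det_coordDeriv (z : SymmCoord m → ℝ) :
    |(c.coordDeriv z).det| =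
      |gapProd (fun i => z (.inr i))| * |(c.formMatrix (fun p => z (.inl p))).det| := by
  rw [coordDeriv, ContinuousLinearMap.det, LinearMap.coe_toContinuousLinearMap, LinearMap.det_comp,
    abs_mul, abs_det_conjCoord (orthogonal_transpose_mul _), LinearMap.det_toLin', det_frameDeriv,
    abs_mul, one_mul]

lemma hasFDerivAt_entry {u : StrictPairs m → ℝ} (hu : u ∈ c.dom) (a i : Fin m) :
    HasFDerivAt (fun v => (c.toFun v : Matrix (Fin m) (Fin m) ℝ) a i)
      (fderiv ℝ (fun v => (c.toFun v : Matrix (Fin m) (Fin m) ℝ) a i) u) u :=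
  (((c.contDiffOn a i).contDiffAt (c.isOpen_dom.mem_nhds hu)).differentiableAt
    one_ne_zero).hasFDerivAt

/-- The derivative of `c.toFun` in direction `v`, entry by entry. -/
noncomputable def velocity (u v : StrictPairs m → ℝ) : Matrix (Fin m) (Fin m) ℝ :=
  Matrix.of fun a i => fderiv ℝ (fun v => (c.toFun v : Matrix (Fin m) (Fin m) ℝ) a i) u v

lemma transpose_mul_velocity_skew {u : StrictPairs m → ℝ} (hu : u ∈ c.dom)
    (v : StrictPairs m → ℝ) :
    ((c.toFun u : Matrix (Fin m) (Fin m) ℝ).transpose * c.velocity u v).transpose =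
      -((c.toFun u : Matrix (Fin m) (Fin m) ℝ).transpose * c.velocity u v) := by
  ext i j
  have h := HasFDerivAt.fun_sum (u := Finset.univ) fun (a : Fin m) _ =>
    (c.hasFDerivAt_entry hu a i).mul (c.hasFDerivAt_entry hu a j)
  have h2 : (fun v => ∑ a, (c.toFun v : Matrix (Fin m) (Fin m) ℝ) a i *
      (c.toFun v : Matrix (Fin m) (Fin m) ℝ) a j) =
      fun _ => (1 : Matrix (Fin m) (Fin m) ℝ) i j := by
    ext w
    rw [← orthogonal_transpose_mul (c.toFun w), Matrix.mul_apply]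
    rfl
  have h3 := h.unique (h2 ▸ hasFDerivAt_const _ u)
  have h4 := DFunLike.congr_fun h3 v
  simp only [_root_.sum_apply, _root_.add_apply,
    _root_.smul_apply, smul_eq_mul, _root_.zero_apply,
    Finset.sum_add_distrib] at h4
  simp only [Matrix.transpose_apply, Matrix.mul_apply, Matrix.neg_apply, velocity, Matrix.of_apply]
  linarith

lemma formMatrix_mulVec (u v : StrictPairs m → ℝ) (p : StrictPairs m) :
    (c.formMatrix u).mulVec v p =
      ((c.toFun u : Matrix (Fin m) (Fin m) ℝ).transpose * c.velocity u v) p.1.2 p.1.1 := by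
  simp only [Matrix.mulVec, dotProduct, formMatrix, Matrix.of_apply, Matrix.mul_apply,
    Matrix.transpose_apply, velocity, Finset.sum_mul]
  rw [Finset.sum_comm]
  refine Finset.sum_congr rfl fun a _ => ?_
  have hv : v = ∑ k, v k • Pi.single k (1 : ℝ) := by
    ext j; simp [Finset.sum_apply, Pi.single_apply]
  conv_rhs => rw [hv, map_sum, Finset.mul_sum]
  refine Finset.sum_congr rfl fun k _ => ?_
  rw [map_smul, smul_eq_mul]
  ring

lemma symmOfCoord_frameDeriv {z : SymmCoord m → ℝ} (hz : (fun p => z (.inl p)) ∈ c.dom)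
    (v : SymmCoord m → ℝ) :
    symmOfCoord m ((c.frameDeriv z).mulVec v) =
      ((c.toFun (fun p => z (.inl p)) : Matrix (Fin m) (Fin m) ℝ).transpose *
          c.velocity (fun p => z (.inl p)) (fun p => v (.inl p))) *
        Matrix.diagonal (fun i => z (.inr i)) -
      Matrix.diagonal (fun i => z (.inr i)) *
        ((c.toFun (fun p => z (.inl p)) : Matrix (Fin m) (Fin m) ℝ).transpose *
          c.velocity (fun p => z (.inl p)) (fun p => v (.inl p))) +
      Matrix.diagonal (fun i => v (.inr i)) := by
  have hs := c.transpose_mul_velocity_skew hz (fun p => v (.inl p))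
  have hf := c.formMatrix_mulVec (fun p => z (.inl p)) (fun p => v (.inl p))
  set W := (c.toFun (fun p => z (.inl p)) : Matrix (Fin m) (Fin m) ℝ).transpose *
    c.velocity (fun p => z (.inl p)) (fun p => v (.inl p))
  have hW (i j) : W j i = - W i j := congrFun (congrFun hs i) j
  have hsym : (W * Matrix.diagonal (fun i => z (.inr i)) -
      Matrix.diagonal (fun i => z (.inr i)) * W +
      Matrix.diagonal (fun i => v (.inr i))).IsSymm := by
    simp only [Matrix.IsSymm, Matrix.transpose_add, Matrix.transpose_sub, Matrix.transpose_mul,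
      Matrix.diagonal_transpose, hs, Matrix.mul_neg, Matrix.neg_mul]
    abel
  rw [← symmOfCoord_coordOfMatrix hsym]
  congr 1
  have hv : v = Sum.elim (fun p => v (.inl p)) (fun i => v (.inr i)) := by ext (_ | _) <;> rfl
  rw [hv, frameDeriv, Matrix.fromBlocks_mulVec]
  ext (p | i)
  · have : p.1.1 ≠ p.1.2 := p.2.ne
    simp [coordOfMatrix, ← Matrix.mulVec_mulVec, Matrix.mulVec_diagonal, Function.comp_def, hf,
      Matrix.mul_diagonal, Matrix.diagonal_mul, this]
    rw [hW p.1.1 p.1.2]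
    ring
  · simp [coordOfMatrix, Matrix.mul_diagonal, Matrix.diagonal_mul, mul_comm]

lemma symmOfCoord_coordDeriv {z : SymmCoord m → ℝ} (hz : (fun p => z (.inl p)) ∈ c.dom)
    (v : SymmCoord m → ℝ) :
    symmOfCoord m (c.coordDeriv z v) =
      c.velocity (fun p => z (.inl p)) (fun p => v (.inl p)) *
        Matrix.diagonal (fun i => z (.inr i)) *
        (c.toFun (fun p => z (.inl p)) : Matrix (Fin m) (Fin m) ℝ).transpose +
      (c.toFun (fun p => z (.inl p)) : Matrix (Fin m) (Fin m) ℝ) *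
        Matrix.diagonal (fun i => z (.inr i)) *
        (c.velocity (fun p => z (.inl p)) (fun p => v (.inl p))).transpose +
      (c.toFun (fun p => z (.inl p)) : Matrix (Fin m) (Fin m) ℝ) *
        Matrix.diagonal (fun i => v (.inr i)) *
        (c.toFun (fun p => z (.inl p)) : Matrix (Fin m) (Fin m) ℝ).transpose := by
  rw [c.coordDeriv_apply, symmOfCoord_conjCoord, c.symmOfCoord_frameDeriv hz]
  exact conj_commutator_eq (orthogonal_mul_transpose (c.toFun (fun p => z (.inl p))))
    (c.transpose_mul_velocity_skew hz (fun p => v (.inl p))) _ _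

lemma hasFDerivAt_conjDiag {z : SymmCoord m → ℝ} (hz : (fun p => z (.inl p)) ∈ c.dom)
    (a b : Fin m) (L : (SymmCoord m → ℝ) →L[ℝ] ℝ)
    (hL : ∀ v, L v = symmOfCoord m (c.coordDeriv z v) a b) :
    HasFDerivAt (fun z : SymmCoord m → ℝ =>
      conjDiag (c.toFun (fun p => z (.inl p)), fun i => z (.inr i)) a b) L z := by
  let pr : (SymmCoord m → ℝ) →L[ℝ] (StrictPairs m → ℝ) :=
    ContinuousLinearMap.pi fun p => ContinuousLinearMap.proj (.inl p)
  have hentry (a i : Fin m) : HasFDerivAt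
      (fun z : SymmCoord m → ℝ => (c.toFun (fun p => z (.inl p)) : Matrix (Fin m) (Fin m) ℝ) a i)
      ((fderiv ℝ (fun v => (c.toFun v : Matrix (Fin m) (Fin m) ℝ) a i) (fun p => z (.inl p))).comp
        pr) z :=
    HasFDerivAt.comp (f := fun z => pr z) z (c.hasFDerivAt_entry hz a i) pr.hasFDerivAt
  have hx (i : Fin m) : HasFDerivAt (fun z : SymmCoord m → ℝ => z (.inr i))
      (ContinuousLinearMap.proj (R := ℝ) (φ := fun _ : SymmCoord m => ℝ) (.inr i)) z :=
    (ContinuousLinearMap.proj (R := ℝ) (φ := fun _ : SymmCoord m => ℝ) (.inr i)).hasFDerivAt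
  have hmat := HasFDerivAt.fun_sum (u := Finset.univ) fun (k : Fin m) _ =>
    ((hentry a k).fun_mul (hx k)).fun_mul (hentry b k)
  simp only [conjDiag_apply]
  refine hmat.congr_fderiv ?_
  ext v
  rw [hL, c.symmOfCoord_coordDeriv hz]
  simp only [Matrix.add_apply, mul_diagonal_mul_transpose_apply,
    ← Finset.sum_add_distrib, _root_.sum_apply, _root_.add_apply, _root_.smul_apply, smul_eq_mul,
    ContinuousLinearMap.comp_apply, ContinuousLinearMap.proj_apply, velocity, Matrix.of_apply]
  refine Finset.sum_congr rfl fun k _ => ?_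
  have e1 : pr v = fun p => v (.inl p) := rfl
  rw [e1]
  ring

lemma hasFDerivAt_coordMap {z : SymmCoord m → ℝ} (hz : (fun p => z (.inl p)) ∈ c.dom) :
    HasFDerivAt c.coordMap (c.coordDeriv z) z := by
  refine hasFDerivAt_pi'.2 ?_
  rintro (p | i)
  · exact c.hasFDerivAt_conjDiag hz p.1.1 p.1.2 _ fun v => (symmOfCoord_of_lt (c.coordDeriv z v) p).symm
  · exact c.hasFDerivAt_conjDiag hz i i _ fun v => (symmOfCoord_diag (c.coordDeriv z v) i).symm

end OrthParam

instance matrixPolishSpace (m : ℕ) : PolishSpace (Matrix (Fin m) (Fin m) ℝ) :=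
  inferInstanceAs (PolishSpace (Fin m → Fin m → ℝ))

lemma isClosed_orthogonalGroup (m : ℕ) :
    IsClosed (Matrix.orthogonalGroup (Fin m) ℝ : Set (Matrix (Fin m) (Fin m) ℝ)) := by
  have : (Matrix.orthogonalGroup (Fin m) ℝ : Set (Matrix (Fin m) (Fin m) ℝ)) =
      {A | A * A.transpose = 1} := by
    ext A; exact Matrix.mem_orthogonalGroup_iff (Fin m) ℝ
  rw [this]
  exact isClosed_eq (by fun_prop) continuous_const

instance orthogonalGroupPolishSpace (m : ℕ) : PolishSpace (Matrix.orthogonalGroup (Fin m) ℝ) :=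
  (isClosed_orthogonalGroup m).polishSpace

/-- The first nonzero entry of `v` has sign `e`. -/
def LeadSign {m : ℕ} (v : Fin m → ℝ) (e : ℤˣ) : Prop :=
  ∃ k, 0 < ((e : ℤ) : ℝ) * v k ∧ ∀ l < k, v l = 0

lemma LeadSign.unique {m : ℕ} {v : Fin m → ℝ} {e e' : ℤˣ} (h : LeadSign v e)
    (h' : LeadSign v e') : e = e' := by
  obtain ⟨k, hk, hl⟩ := h
  obtain ⟨k', hk', hl'⟩ := h'
  have hkk : k = k' := by
    rcases lt_trichotomy k k' with h | h | h
    · simp [hl' k h] at hk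
    · exact h
    · simp [hl k' h] at hk'
  subst hkk
  rcases Int.units_eq_one_or e with rfl | rfl <;> rcases Int.units_eq_one_or e' with rfl | rfl <;>
    first | rfl | (exfalso; push_cast at hk hk'; linarith)

lemma exists_leadSign {m : ℕ} {v : Fin m → ℝ} (hv : v ≠ 0) : ∃ e, LeadSign v e := by
  have hne : (Finset.univ.filter fun k => v k ≠ 0).Nonempty := by
    obtain ⟨k, hk⟩ := Function.ne_iff.1 hv
    exact ⟨k, by simpa using hk⟩
  have hmin := Finset.min'_mem _ hne
  set k := Finset.min' _ hne with hkdef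
  have hk : v k ≠ 0 := by simpa using hmin
  have hl : ∀ l < k, v l = 0 := fun l hlk => by
    by_contra h0
    exact absurd (Finset.min'_le (Finset.univ.filter fun k => v k ≠ 0) l (by simpa using h0))
      (not_le.2 hlk)
  rcases hk.lt_or_gt with h | h
  · exact ⟨-1, k, by push_cast; linarith, hl⟩
  · exact ⟨1, k, by push_cast; linarith, hl⟩

lemma LeadSign.mul {m : ℕ} {v : Fin m → ℝ} {e : ℤˣ} (h : LeadSign v e) (t : ℤˣ) :
    LeadSign (fun k => v k * ((t : ℤ) : ℝ)) (t * e) := by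
  obtain ⟨k, hk, hl⟩ := h
  refine ⟨k, ?_, fun l h => by simp [hl l h]⟩
  have : ((t : ℤ) : ℝ) * ((t : ℤ) : ℝ) = 1 := by
    rcases Int.units_eq_one_or t with rfl | rfl <;> simp
  calc (0 : ℝ) < (((e : ℤ) : ℝ) * v k) * (((t : ℤ) : ℝ) * ((t : ℤ) : ℝ)) := by
        rwa [this, mul_one]
    _ = _ := by push_cast; ring

/-- The orthogonal matrices whose columns have leading entries of the given signs. -/
def signPiece {m : ℕ} (s : Fin m → ℤˣ) : Set (Matrix.orthogonalGroup (Fin m) ℝ) :=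
  {H | ∀ i, LeadSign (fun a => (H : Matrix (Fin m) (Fin m) ℝ) a i) (s i)}

lemma continuous_orthogonal_entry {m : ℕ} (a i : Fin m) :
    Continuous fun H : Matrix.orthogonalGroup (Fin m) ℝ => (H : Matrix (Fin m) (Fin m) ℝ) a i :=
  (continuous_apply_apply a i).comp continuous_subtype_val

lemma measurableSet_signPiece {m : ℕ} (s : Fin m → ℤˣ) : MeasurableSet (signPiece s) := by
  have hm (a i : Fin m) := (continuous_orthogonal_entry a i).measurable
  have : signPiece s = ⋂ i, ⋃ k, ({H : Matrix.orthogonalGroup (Fin m) ℝ | 0 < (((s i : ℤˣ) : ℤ) : ℝ) *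
      (H : Matrix (Fin m) (Fin m) ℝ) k i} ∩
      ⋂ l, ⋂ (_ : l < k), {H : Matrix.orthogonalGroup (Fin m) ℝ | (H : Matrix (Fin m) (Fin m) ℝ) l i = 0}) := by
    ext H; simp [signPiece, LeadSign]
  rw [this]
  refine MeasurableSet.iInter fun i => MeasurableSet.iUnion fun k => MeasurableSet.inter ?_ ?_
  · exact measurableSet_lt measurable_const ((hm k i).const_mul _)
  · exact MeasurableSet.iInter fun l => MeasurableSet.iInter fun _ =>
      measurableSet_eq_fun (hm l i) measurable_const

lemma pairwise_disjoint_signPiece (m : ℕ) :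
    Pairwise (Function.onFun Disjoint (signPiece (m := m))) := fun _ _ hss =>
  Set.disjoint_left.2 fun _ h h' => hss (funext fun i => (h i).unique (h' i))

lemma exists_mem_signPiece {m : ℕ} (H : Matrix.orthogonalGroup (Fin m) ℝ) :
    ∃ s, H ∈ signPiece s := by
  have (i : Fin m) : ∃ e, LeadSign (fun a => (H : Matrix (Fin m) (Fin m) ℝ) a i) e := by
    refine exists_leadSign fun h => ?_
    have h1 := congrFun (congrFun (orthogonal_transpose_mul H) i) i
    rw [Matrix.mul_apply] at h1
    simp [fun a => congrFun h a] at h1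
  choose s hs using this
  exact ⟨s, hs⟩

lemma iUnion_signPiece (m : ℕ) : ⋃ s, signPiece (m := m) s = Set.univ :=
  Set.eq_univ_of_forall fun H => Set.mem_iUnion.2 (exists_mem_signPiece H)

/-- Flipping the signs of the columns of an orthogonal matrix. -/
def flipColumns {m : ℕ} (H : Matrix.orthogonalGroup (Fin m) ℝ) (t : Fin m → ℤˣ) :
    Matrix.orthogonalGroup (Fin m) ℝ :=
  ⟨(H : Matrix (Fin m) (Fin m) ℝ) * Matrix.diagonal fun i => ((t i : ℤ) : ℝ), by
    have ht : (fun i => ((t i : ℤ) : ℝ) * ((t i : ℤ) : ℝ)) = fun _ => 1 := by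
      ext i; rcases Int.units_eq_one_or (t i) with h | h <;> simp [h]
    rw [Matrix.mem_orthogonalGroup_iff]
    calc _ = (H : Matrix (Fin m) (Fin m) ℝ) * ((Matrix.diagonal fun i => ((t i : ℤ) : ℝ)) *
          (Matrix.diagonal fun i => ((t i : ℤ) : ℝ))) * (H : Matrix (Fin m) (Fin m) ℝ).transpose := by
          rw [Matrix.transpose_mul, Matrix.diagonal_transpose]
          simp only [Matrix.mul_assoc]
      _ = 1 := by
          rw [Matrix.diagonal_mul_diagonal, ht, Matrix.diagonal_one, Matrix.mul_one,
            orthogonal_mul_transpose]⟩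

lemma flipColumns_apply {m : ℕ} (H : Matrix.orthogonalGroup (Fin m) ℝ) (t : Fin m → ℤˣ)
    (a i : Fin m) : (flipColumns H t : Matrix (Fin m) (Fin m) ℝ) a i =
      (H : Matrix (Fin m) (Fin m) ℝ) a i * ((t i : ℤ) : ℝ) := by
  simp [flipColumns, Matrix.mul_diagonal]

lemma conjDiag_flipColumns {m : ℕ} (H : Matrix.orthogonalGroup (Fin m) ℝ) (t : Fin m → ℤˣ)
    (x : Fin m → ℝ) : conjDiag (flipColumns H t, x) = conjDiag (H, x) := by
  ext a b
  rw [conjDiag_apply, conjDiag_apply]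
  refine Finset.sum_congr rfl fun k _ => ?_
  simp only [flipColumns_apply]
  rcases Int.units_eq_one_or (t k) with h | h <;> simp [h]

lemma image_conjDiag_signPiece {m : ℕ} (s : Fin m → ℤˣ) (B : Set (Fin m → ℝ)) :
    conjDiag '' (signPiece s ×ˢ B) = conjDiag '' (Set.univ ×ˢ B) := by
  refine (Set.image_mono (Set.prod_mono_left (Set.subset_univ _))).antisymm ?_
  rintro _ ⟨⟨H, x⟩, ⟨-, hx⟩, rfl⟩
  obtain ⟨s', hs'⟩ := exists_mem_signPiece H
  refine ⟨(flipColumns H fun i => s i * (s' i)⁻¹, x), ⟨fun i => ?_, hx⟩,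
    conjDiag_flipColumns _ _ _⟩
  have := (hs' i).mul (s i * (s' i)⁻¹)
  rw [inv_mul_cancel_right] at this
  simpa only [flipColumns_apply] using this

lemma transpose_mul_apply_mul_sub_eq_zero {m : ℕ} {H H' : Matrix.orthogonalGroup (Fin m) ℝ}
    {x x' : Fin m → ℝ} (h : conjDiag (H, x) = conjDiag (H', x')) (i j : Fin m) :
    ((H' : Matrix (Fin m) (Fin m) ℝ).transpose * (H : Matrix (Fin m) (Fin m) ℝ)) i j *
      (x j - x' i) = 0 := by
  have h1 : (H' : Matrix (Fin m) (Fin m) ℝ).transpose * (H : Matrix (Fin m) (Fin m) ℝ) *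
      Matrix.diagonal x = Matrix.diagonal x' *
      ((H' : Matrix (Fin m) (Fin m) ℝ).transpose * (H : Matrix (Fin m) (Fin m) ℝ)) := by
    have h2 := congrArg (fun A => (H' : Matrix (Fin m) (Fin m) ℝ).transpose * A *
      (H : Matrix (Fin m) (Fin m) ℝ)) h
    simp only [conjDiag] at h2
    calc _ = (H' : Matrix (Fin m) (Fin m) ℝ).transpose * ((H : Matrix (Fin m) (Fin m) ℝ) *
          Matrix.diagonal x * (H : Matrix (Fin m) (Fin m) ℝ).transpose) *
          (H : Matrix (Fin m) (Fin m) ℝ) := by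
          simp only [Matrix.mul_assoc, orthogonal_transpose_mul, Matrix.mul_one]
      _ = _ := h2
      _ = _ := by
          simp only [← Matrix.mul_assoc, orthogonal_transpose_mul, Matrix.one_mul]
  have h3 := congrFun (congrFun h1 i) j
  rw [Matrix.mul_diagonal, Matrix.diagonal_mul] at h3
  linear_combination h3

lemma eq_flipColumns_of_conjDiag_eq {m : ℕ} {H H' : Matrix.orthogonalGroup (Fin m) ℝ}
    {x x' : Fin m → ℝ} (hx : StrictAnti x) (hx' : StrictAnti x')
    (h : conjDiag (H, x) = conjDiag (H', x')) : x = x' ∧ ∃ t, H = flipColumns H' t := by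
  have hsub {H H' : Matrix.orthogonalGroup (Fin m) ℝ} {x x' : Fin m → ℝ}
      (h : conjDiag (H, x) = conjDiag (H', x')) : Set.range x ⊆ Set.range x' := by
    rintro _ ⟨j, rfl⟩
    by_contra hj
    have hK : ∀ i, ((H' : Matrix (Fin m) (Fin m) ℝ).transpose *
        (H : Matrix (Fin m) (Fin m) ℝ)) i j = 0 := fun i =>
      (mul_eq_zero.1 (transpose_mul_apply_mul_sub_eq_zero h i j)).resolve_right fun h0 =>
        hj ⟨i, by linarith⟩
    have h1 := congrFun (congrFun (orthogonal_transpose_mul (H'⁻¹ * H)) j) j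
    rw [Matrix.mul_apply] at h1
    have h2 : ((H'⁻¹ * H : Matrix.orthogonalGroup (Fin m) ℝ) : Matrix (Fin m) (Fin m) ℝ) =
      (H' : Matrix (Fin m) (Fin m) ℝ).transpose * (H : Matrix (Fin m) (Fin m) ℝ) := rfl
    simp [h2, hK] at h1
  have hxx : x = x' := by
    have hr : Set.range (fun i => -x i) = Set.range (fun i => -x' i) := by
      have := (hsub h).antisymm (hsub h.symm)
      have := congrArg (fun s => Neg.neg '' s) this
      rwa [← Set.range_comp, ← Set.range_comp] at this
    have := (StrictMono.range_inj (f := fun i => -x i) (g := fun i => -x' i)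
      (fun i j hij => neg_lt_neg (hx hij)) (fun i j hij => neg_lt_neg (hx' hij))).1 hr
    ext i
    exact neg_injective (congrFun this i)
  refine ⟨hxx, ?_⟩
  subst hxx
  set K := (H' : Matrix (Fin m) (Fin m) ℝ).transpose * (H : Matrix (Fin m) (Fin m) ℝ) with hK
  have hoff (i j : Fin m) (hij : i ≠ j) : K i j = 0 :=
    (mul_eq_zero.1 (transpose_mul_apply_mul_sub_eq_zero h i j)).resolve_right fun h0 =>
      hij (hx.injective (by linarith)).symm
  have hdiag (i : Fin m) : ∃ t : ℤˣ, K i i = ((t : ℤ) : ℝ) := by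
    have h1 := congrFun (congrFun (orthogonal_transpose_mul (H'⁻¹ * H)) i) i
    have h2 : ((H'⁻¹ * H : Matrix.orthogonalGroup (Fin m) ℝ) : Matrix (Fin m) (Fin m) ℝ) = K := rfl
    rw [Matrix.mul_apply, h2, Finset.sum_eq_single i] at h1
    · rw [Matrix.transpose_apply, Matrix.one_apply_eq] at h1
      rcases mul_self_eq_one_iff.1 h1 with h | h
      · exact ⟨1, by simp [h]⟩
      · exact ⟨-1, by simp [h]⟩
    · intro b _ hb; simp [hoff b i hb]
    · simp
  choose t ht using hdiag
  refine ⟨t, Subtype.ext ?_⟩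
  have hKd : K = Matrix.diagonal fun i => ((t i : ℤ) : ℝ) := by
    ext i j
    by_cases hij : i = j
    · subst hij; simp [ht]
    · simp [hij, hoff i j hij]
  change _ = (H' : Matrix (Fin m) (Fin m) ℝ) * Matrix.diagonal fun i => ((t i : ℤ) : ℝ)
  rw [← hKd, hK, ← Matrix.mul_assoc, orthogonal_mul_transpose, Matrix.one_mul]

lemma injOn_conjDiag {m : ℕ} (s : Fin m → ℤˣ) :
    Set.InjOn conjDiag (signPiece s ×ˢ {x : Fin m → ℝ | StrictAnti x}) := by
  rintro ⟨H, x⟩ ⟨hH, hx⟩ ⟨H', x'⟩ ⟨hH', hx'⟩ h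
  obtain ⟨rfl, t, rfl⟩ := eq_flipColumns_of_conjDiag_eq hx hx' h
  congr 1
  ext a i
  have h1 := (hH' i).mul (t i)
  have h2 := hH i
  simp only [flipColumns_apply] at h2 ⊢
  have h3 : t i = 1 := by simpa using h1.unique h2
  simp [h3]

lemma measurable_conjDiag (m : ℕ) : Measurable (conjDiag (m := m)) := by
  refine measurable_pi_iff.2 fun a => measurable_pi_iff.2 fun b => ?_
  simp only [conjDiag_apply]
  refine Finset.measurable_sum _ fun k _ => Measurable.mul (Measurable.mul ?_ ?_) ?_
  · exact (continuous_orthogonal_entry a k).measurable.comp measurable_fst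
  · exact (measurable_pi_apply k).comp measurable_snd
  · exact (continuous_orthogonal_entry b k).measurable.comp measurable_fst

lemma measurable_gapProd (m : ℕ) : Measurable (gapProd (m := m)) := by
  unfold gapProd
  fun_prop

lemma isOpen_strictAnti (m : ℕ) : IsOpen {x : Fin m → ℝ | StrictAnti x} := by
  have : {x : Fin m → ℝ | StrictAnti x} = ⋂ p : StrictPairs m, {x | x p.1.2 < x p.1.1} := by
    ext x
    simp only [Set.mem_ofPred_eq, Set.mem_iInter]
    exact ⟨fun h p => h p.2, fun h i j hij => h ⟨(i, j), hij⟩⟩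
  rw [this]
  exact isOpen_iInter_of_finite fun p =>
    isOpen_lt (continuous_apply _) (continuous_apply _)

/-- The index set of the free entries, split into off-diagonal and diagonal ones. -/
def symmCoordEquiv (m : ℕ) : SymmCoord m ≃ WeakPairs m where
  toFun := Sum.elim (fun p => ⟨p.1, p.2.le⟩) (fun i => ⟨(i, i), le_rfl⟩)
  invFun p := if h : p.1.1 < p.1.2 then .inl ⟨p.1, h⟩ else .inr p.1.1
  left_inv := by
    rintro (⟨p, h⟩ | i)
    · simp [h]
    · simp
  right_inv := by
    rintro ⟨⟨i, j⟩, h⟩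
    by_cases h' : i < j
    · simp [h']
    · have : i = j := le_antisymm h (not_lt.1 h')
      subst this
      simp

lemma measurableEmbedding_symmOfCoord (m : ℕ) : MeasurableEmbedding (symmOfCoord m) :=
  (LinearMap.continuous_of_finiteDimensional (symmOfCoord m)).measurableEmbedding
    (Function.LeftInverse.injective (g := coordOfMatrix m) coordOfMatrix_symmOfCoord)

lemma symmLebesgue_eq_map (m : ℕ) :
    symmLebesgue m = (volume : Measure (SymmCoord m → ℝ)).map (symmOfCoord m) := by
  have hp := (volume_measurePreserving_piCongrLeft (fun _ : WeakPairs m => ℝ)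
    (symmCoordEquiv m)).symm
  rw [← hp.map_eq, Measure.map_map (measurableEmbedding_symmOfCoord m).measurable hp.measurable]
  rw [symmLebesgue]
  congr 1
  ext a i j
  change _ = symmOfCoord m (fun k => a (symmCoordEquiv m k)) i j
  rcases lt_trichotomy i j with h | rfl | h
  · rw [symmOfCoord_of_lt _ ⟨(i, j), h⟩]
    simp [symmOfUpper, symmCoordEquiv, h.le]
  · rw [symmOfCoord_diag]
    simp [symmOfUpper, symmCoordEquiv]
  · rw [symmOfCoord_of_gt _ ⟨(j, i), h⟩]
    simp [symmOfUpper, symmCoordEquiv, h.le]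

/-- The skew-symmetric matrix with given entries above the diagonal. -/
def skewOfCoord {m : ℕ} (u : StrictPairs m → ℝ) : Matrix (Fin m) (Fin m) ℝ :=
  Matrix.of fun i j =>
    if h : i < j then u ⟨(i, j), h⟩ else if h : j < i then -u ⟨(j, i), h⟩ else 0

lemma skewOfCoord_transpose {m : ℕ} (u : StrictPairs m → ℝ) :
    (skewOfCoord u).transpose = -skewOfCoord u := by
  ext i j
  rcases lt_trichotomy i j with h | rfl | h
  · simp [skewOfCoord, h, h.not_gt]
  · simp [skewOfCoord]
  · simp [skewOfCoord, h, h.not_gt]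

lemma skewOfCoord_injective {m : ℕ} : Function.Injective (skewOfCoord (m := m)) := by
  intro u v h
  ext p
  have := congrFun (congrFun h p.1.1) p.1.2
  simpa [skewOfCoord, p.2] using this

lemma exists_skewOfCoord_eq {m : ℕ} {X : Matrix (Fin m) (Fin m) ℝ} (hX : X.transpose = -X) :
    ∃ u, skewOfCoord u = X := by
  have hX' (i j) : X j i = -X i j := congrFun (congrFun hX i) j
  refine ⟨fun p => X p.1.1 p.1.2, ?_⟩
  ext i j
  rcases lt_trichotomy i j with h | rfl | h
  · simp [skewOfCoord, h]
  · simp only [skewOfCoord, Matrix.of_apply, lt_irrefl, dite_false]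
    linarith [hX' i i]
  · simp [skewOfCoord, h, h.not_gt, hX' i j]

lemma isUnit_det_one_add_of_skew {m : ℕ} {X : Matrix (Fin m) (Fin m) ℝ} (hX : X.transpose = -X) :
    IsUnit (1 + X).det := by
  rw [isUnit_iff_ne_zero]
  intro h
  obtain ⟨v, hv, h0⟩ := Matrix.exists_mulVec_eq_zero_iff.2 h
  have h1 : v ⬝ᵥ X.mulVec v = 0 := by
    have : v ⬝ᵥ X.mulVec v = -(v ⬝ᵥ X.mulVec v) := by
      conv_lhs => rw [Matrix.dotProduct_mulVec, ← Matrix.mulVec_transpose, hX, Matrix.neg_mulVec,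
        neg_dotProduct, dotProduct_comm]
    linarith
  have h2 : v ⬝ᵥ (1 + X).mulVec v = v ⬝ᵥ v := by
    rw [Matrix.add_mulVec, Matrix.one_mulVec, dotProduct_add, h1, add_zero]
  rw [h0, dotProduct_zero] at h2
  exact hv (dotProduct_self_eq_zero.1 h2.symm)

/-- The Cayley transform of a matrix. -/
noncomputable def cayley {m : ℕ} (X : Matrix (Fin m) (Fin m) ℝ) : Matrix (Fin m) (Fin m) ℝ :=
  (2 : ℝ) • (1 + X)⁻¹ - 1

lemma inv_add_inv_eq {m : ℕ} {P Q : Matrix (Fin m) (Fin m) ℝ} (hP : IsUnit P.det)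
    (hQ : IsUnit Q.det) : P⁻¹ + Q⁻¹ = P⁻¹ * (P + Q) * Q⁻¹ := by
  rw [Matrix.mul_add, Matrix.add_mul, Matrix.nonsing_inv_mul _ hP, Matrix.mul_assoc,
    Matrix.mul_nonsing_inv _ hQ, Matrix.one_mul, Matrix.mul_one, add_comm]

lemma cayley_mul_transpose {m : ℕ} {X : Matrix (Fin m) (Fin m) ℝ} (hX : X.transpose = -X) :
    cayley X * (cayley X).transpose = 1 := by
  have h1 := isUnit_det_one_add_of_skew hX
  have h2 : IsUnit (1 + X).transpose.det := by rwa [Matrix.det_transpose]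
  have h3 : (1 + X) + (1 + X).transpose = (2 : ℝ) • 1 := by
    rw [Matrix.transpose_add, hX, Matrix.transpose_one, two_smul]; abel
  have h4 := inv_add_inv_eq h1 h2
  rw [h3, Matrix.mul_smul, Matrix.smul_mul, Matrix.mul_one] at h4
  have h5 : (cayley X).transpose = (2 : ℝ) • ((1 + X).transpose)⁻¹ - 1 := by
    rw [cayley, Matrix.transpose_sub, Matrix.transpose_smul, Matrix.transpose_nonsing_inv,
      Matrix.transpose_one]
  rw [h5, cayley]
  set P := (1 + X)⁻¹
  set Q := (1 + X).transpose⁻¹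
  calc _ = (2 : ℝ) • ((2 : ℝ) • (P * Q) - (P + Q)) + 1 := by
        simp only [Matrix.sub_mul, Matrix.mul_sub, Matrix.smul_mul, Matrix.mul_smul,
          Matrix.one_mul, Matrix.mul_one, smul_sub, smul_add]
        abel
    _ = 1 := by rw [h4, sub_self, smul_zero, zero_add]

lemma one_add_cayley {m : ℕ} (X : Matrix (Fin m) (Fin m) ℝ) :
    1 + cayley X = (2 : ℝ) • (1 + X)⁻¹ := by
  rw [cayley]; abel

lemma cayley_inj {m : ℕ} {X Y : Matrix (Fin m) (Fin m) ℝ} (hX : IsUnit (1 + X).det)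
    (hY : IsUnit (1 + Y).det) (h : cayley X = cayley Y) : X = Y := by
  have h1 : (2 : ℝ) • (1 + X)⁻¹ = (2 : ℝ) • (1 + Y)⁻¹ := by
    rw [← one_add_cayley, ← one_add_cayley, h]
  have h2 : (1 + X)⁻¹ = (1 + Y)⁻¹ := smul_right_injective _ (two_ne_zero (α := ℝ)) h1
  have h3 := congrArg (fun A => A⁻¹) h2
  simp only [Matrix.nonsing_inv_nonsing_inv _ hX, Matrix.nonsing_inv_nonsing_inv _ hY] at h3
  exact add_left_cancel h3

lemma cayley_cayley {m : ℕ} {X : Matrix (Fin m) (Fin m) ℝ} (hX : IsUnit (1 + X).det) :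
    cayley (cayley X) = X := by
  have h : ((2 : ℝ) • (1 + X)⁻¹)⁻¹ = (2 : ℝ)⁻¹ • (1 + X) := by
    refine Matrix.inv_eq_left_inv ?_
    rw [Matrix.smul_mul, Matrix.mul_smul, smul_smul, Matrix.mul_nonsing_inv _ hX]
    norm_num
  rw [cayley, one_add_cayley, h, smul_smul]
  norm_num

lemma cayley_transpose_of_orthogonal {m : ℕ} {H : Matrix (Fin m) (Fin m) ℝ}
    (hH : H * H.transpose = 1) (h1 : IsUnit (1 + H).det) :
    (cayley H).transpose = -cayley H := by
  have h2 : IsUnit (1 + H).transpose.det := by rwa [Matrix.det_transpose]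
  have h3 : (1 + H) + (1 + H).transpose = (1 + H) * (1 + H).transpose := by
    rw [Matrix.transpose_add, Matrix.transpose_one]
    simp only [Matrix.mul_add, Matrix.add_mul, hH, Matrix.mul_one, Matrix.one_mul]
    abel
  have h4 := inv_add_inv_eq h1 h2
  rw [h3, ← Matrix.mul_assoc, Matrix.nonsing_inv_mul _ h1, Matrix.one_mul,
    Matrix.mul_nonsing_inv _ h2] at h4
  rw [cayley, Matrix.transpose_sub, Matrix.transpose_smul, Matrix.transpose_nonsing_inv,
      Matrix.transpose_one, eq_sub_of_add_eq' h4, smul_sub, two_smul]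
  abel

lemma contDiff_det {m : ℕ} {E : Type*} [NormedAddCommGroup E] [NormedSpace ℝ E] {n : WithTop ℕ∞}
    {A : E → Matrix (Fin m) (Fin m) ℝ} (hA : ∀ i j, ContDiff ℝ n fun u => A u i j) :
    ContDiff ℝ n fun u => (A u).det := by
  simp only [Matrix.det_apply]
  exact ContDiff.sum fun σ _ => (contDiff_prod fun i _ => hA _ _).const_smul _

lemma contDiff_inv_entry {m : ℕ} {E : Type*} [NormedAddCommGroup E] [NormedSpace ℝ E]
    {n : WithTop ℕ∞} {A : E → Matrix (Fin m) (Fin m) ℝ}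
    (hA : ∀ i j, ContDiff ℝ n fun u => A u i j) (h0 : ∀ u, (A u).det ≠ 0) (i j : Fin m) :
    ContDiff ℝ n fun u => (A u)⁻¹ i j := by
  simp only [Matrix.inv_def, Matrix.smul_apply, smul_eq_mul, Ring.inverse_eq_inv',
    Matrix.adjugate_apply]
  refine ((contDiff_det hA).inv h0).mul (contDiff_det fun a b => ?_)
  by_cases h : a = j
  · subst h; simp only [Matrix.updateRow_self]; exact contDiff_const
  · simp only [Matrix.updateRow_ne h]; exact hA a b

lemma contDiff_skewOfCoord {m : ℕ} {n : WithTop ℕ∞} (i j : Fin m) :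
    ContDiff ℝ n fun u => skewOfCoord u i j := by
  simp only [skewOfCoord, Matrix.of_apply]
  split_ifs
  · exact contDiff_apply _ _ _
  · exact (contDiff_apply _ _ _).neg
  · exact contDiff_const

/-- The Cayley parametrization of `O(m)` around `H`. -/
noncomputable def cayleyParam {m : ℕ} (H : Matrix.orthogonalGroup (Fin m) ℝ) : OrthParam m where
  dom := Set.univ
  toFun u := H * ⟨cayley (skewOfCoord u), (Matrix.mem_orthogonalGroup_iff (Fin m) ℝ).2
    (cayley_mul_transpose (skewOfCoord_transpose u))⟩
  isOpen_dom := isOpen_univ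
  injOn := fun u _ v _ h => skewOfCoord_injective <|
    cayley_inj (isUnit_det_one_add_of_skew (skewOfCoord_transpose u))
      (isUnit_det_one_add_of_skew (skewOfCoord_transpose v))
      (congrArg Subtype.val (mul_left_cancel h))
  contDiffOn a i := by
    refine ContDiff.contDiffOn ?_
    change ContDiff ℝ 1 fun u =>
      ((H : Matrix (Fin m) (Fin m) ℝ) * cayley (skewOfCoord u) : Matrix (Fin m) (Fin m) ℝ) a i
    simp only [Matrix.mul_apply, cayley, Matrix.sub_apply, Matrix.smul_apply]
    refine ContDiff.sum fun k _ => contDiff_const.mul (ContDiff.sub (ContDiff.const_smul _ ?_)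
      contDiff_const)
    refine contDiff_inv_entry (fun p q => ?_)
      (fun u => (isUnit_det_one_add_of_skew (skewOfCoord_transpose u)).ne_zero) k i
    simp only [Matrix.add_apply]
    exact contDiff_const.add (contDiff_skewOfCoord p q)

lemma mem_image_cayleyParam {m : ℕ} {H K : Matrix.orthogonalGroup (Fin m) ℝ}
    (h : (1 + ((H⁻¹ * K : Matrix.orthogonalGroup (Fin m) ℝ) : Matrix (Fin m) (Fin m) ℝ)).det ≠ 0) :
    K ∈ (cayleyParam H).toFun '' (cayleyParam H).dom := by
  have hu := isUnit_iff_ne_zero.2 h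
  obtain ⟨u, hu'⟩ := exists_skewOfCoord_eq
    (cayley_transpose_of_orthogonal (orthogonal_mul_transpose (H⁻¹ * K)) hu)
  refine ⟨u, Set.mem_univ _, ?_⟩
  refine eq_inv_mul_iff_mul_eq.1 (Subtype.ext ?_)
  change cayley (skewOfCoord u) = _
  rw [hu', cayley_cayley hu]

lemma exists_seq_orthParam_cover (m : ℕ) :
    ∃ c : ℕ → OrthParam m, ⋃ n, (c n).toFun '' (c n).dom = Set.univ := by
  have hn (H : Matrix.orthogonalGroup (Fin m) ℝ) :
      {K : Matrix.orthogonalGroup (Fin m) ℝ | (1 + ((H⁻¹ * K : Matrix.orthogonalGroup (Fin m) ℝ) :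
        Matrix (Fin m) (Fin m) ℝ)).det ≠ 0} ∈ nhds H := by
    refine IsOpen.mem_nhds ?_ ?_
    · refine isOpen_ne_fun (Continuous.matrix_det ?_) continuous_const
      change Continuous fun K : Matrix.orthogonalGroup (Fin m) ℝ =>
        1 + (H : Matrix (Fin m) (Fin m) ℝ).transpose * (K : Matrix (Fin m) (Fin m) ℝ)
      fun_prop
    · have : (1 : Matrix (Fin m) (Fin m) ℝ) + 1 = (2 : ℝ) • 1 := (two_smul _ _).symm
      simp [this]
  obtain ⟨s, hs, hcov⟩ := TopologicalSpace.countable_cover_nhds hn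
  have hne : s.Nonempty := by
    by_contra h
    rw [Set.not_nonempty_iff_eq_empty] at h
    have h1 : (1 : Matrix.orthogonalGroup (Fin m) ℝ) ∈ (Set.univ : Set _) := Set.mem_univ _
    rw [← hcov, h] at h1
    simp at h1
  obtain ⟨f, rfl⟩ := hs.exists_eq_range hne
  refine ⟨fun n => cayleyParam (f n), Set.eq_univ_of_forall fun K => ?_⟩
  have hK : K ∈ (Set.univ : Set (Matrix.orthogonalGroup (Fin m) ℝ)) := Set.mem_univ _
  rw [← hcov] at hK
  simp only [Set.mem_range, Set.iUnion_exists, Set.iUnion_iUnion_eq', Set.mem_iUnion] at hK ⊢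
  obtain ⟨n, hn⟩ := hK
  exact ⟨n, mem_image_cayleyParam hn⟩

namespace OrthParam

variable {m : ℕ} (c : OrthParam m)

/-- The absolute value of the coefficient of the pulled-back form, extended by zero. -/
noncomputable def density : (StrictPairs m → ℝ) → ℝ≥0∞ :=
  c.dom.indicator fun u => ENNReal.ofReal |(c.formMatrix u).det|

open Classical in
/-- The parametrization, extended by a constant. -/
noncomputable def extend : (StrictPairs m → ℝ) → Matrix.orthogonalGroup (Fin m) ℝ :=
  c.dom.piecewise c.toFun fun _ => 1

lemma extend_of_mem {u : StrictPairs m → ℝ} (hu : u ∈ c.dom) : c.extend u = c.toFun u := by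
  classical exact Set.piecewise_eq_of_mem _ _ _ hu

lemma continuousOn_toFun : ContinuousOn c.toFun c.dom := by
  rw [continuousOn_iff_continuous_domRestrict]
  refine continuous_induced_rng.2 (continuous_pi fun a => continuous_pi fun i => ?_)
  exact continuousOn_iff_continuous_domRestrict.1 (c.contDiffOn a i).continuousOn

lemma measurable_extend : Measurable c.extend := by
  classical exact c.continuousOn_toFun.measurable_piecewise continuousOn_const c.isOpen_dom.measurableSet

lemma continuousOn_det_formMatrix : ContinuousOn (fun u => (c.formMatrix u).det) c.dom := by
  have h : ContinuousOn c.formMatrix c.dom := by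
    refine continuousOn_pi.2 fun p => continuousOn_pi.2 fun k => ?_
    refine continuousOn_finsetSum (Finset.univ : Finset (Fin m))
      (f := fun a u => (c.toFun u : Matrix (Fin m) (Fin m) ℝ) a p.1.2 *
        fderiv ℝ (fun v => (c.toFun v : Matrix (Fin m) (Fin m) ℝ) a p.1.1) u (Pi.single k 1))
      fun a _ => (c.contDiffOn a _).continuousOn.mul ?_
    exact ((c.contDiffOn a _).continuousOn_fderiv_of_isOpen c.isOpen_dom le_rfl).clm_apply
      continuousOn_const
  exact (Continuous.matrix_det continuous_id).comp_continuousOn h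

lemma measurable_density : Measurable c.density := by
  classical
  rw [density, ← Set.piecewise_eq_indicator]
  exact (ENNReal.continuous_ofReal.comp_continuousOn
    c.continuousOn_det_formMatrix.abs).measurable_piecewise continuousOn_const
      c.isOpen_dom.measurableSet

lemma measure_eq : c.measure = (volume.withDensity c.density).map c.extend := by
  rw [density, withDensity_indicator c.isOpen_dom.measurableSet, measure]
  refine Measure.map_congr ((withDensity_absolutelyContinuous _ _).ae_eq ?_)
  filter_upwards [ae_restrict_mem c.isOpen_dom.measurableSet] with u hu
  exact (c.extend_of_mem hu).symm

instance : SFinite c.measure := by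
  rw [measure_eq]; infer_instance

lemma setLIntegral_measure {E : Set (Matrix.orthogonalGroup (Fin m) ℝ)} (hE : MeasurableSet E)
    {F : Matrix.orthogonalGroup (Fin m) ℝ → ℝ≥0∞} (hF : Measurable F) :
    ∫⁻ H in E, F H ∂c.measure =
      ∫⁻ u in c.extend ⁻¹' E ∩ c.dom, c.density u * F (c.extend u) := by
  rw [measure_eq, setLIntegral_map hE hF c.measurable_extend,
    setLIntegral_withDensity_eq_setLIntegral_mul (f := c.density) (g := fun u => F (c.extend u)) _
      c.measurable_density (hF.comp c.measurable_extend) (c.measurable_extend hE)]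
  have : (c.density * fun u => F (c.extend u)) =
      c.dom.indicator fun u => c.density u * F (c.extend u) := by
    ext u
    by_cases hu : u ∈ c.dom
    · simp [hu]
    · simp [density, hu]
  rw [this, setLIntegral_indicator c.isOpen_dom.measurableSet, Set.inter_comm]

lemma measurableSet_image {s : Set (StrictPairs m → ℝ)} (hs : MeasurableSet s)
    (hsub : s ⊆ c.dom) : MeasurableSet (c.toFun '' s) :=
  hs.image_of_continuousOn_injOn (c.continuousOn_toFun.mono hsub) (c.injOn.mono hsub)

lemma measurable_weight {T : Set (Matrix (Fin m) (Fin m) ℝ)} (hT : MeasurableSet T) :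
    Measurable fun q : Matrix.orthogonalGroup (Fin m) ℝ × (Fin m → ℝ) =>
      ENNReal.ofReal |gapProd q.2| * T.indicator 1 (conjDiag q) := by
  refine Measurable.mul ?_ ((measurable_one.indicator hT).comp (measurable_conjDiag m))
  exact ((measurable_gapProd m).comp measurable_snd).abs.ennreal_ofReal

lemma symmOfCoord_coordMap (z : SymmCoord m → ℝ) : symmOfCoord m (c.coordMap z) =
    conjDiag (c.toFun (fun p => z (.inl p)), fun i => z (.inr i)) :=
  symmOfCoord_coordOfMatrix (isSymm_conjDiag _)

/-- The coordinates `(u, x)` with `u` in the domain of `c`, `c(u)` in `E` and `x` in `B`. -/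
def coordPreimage (E : Set (Matrix.orthogonalGroup (Fin m) ℝ)) (B : Set (Fin m → ℝ)) :
    Set (SymmCoord m → ℝ) :=
  (MeasurableEquiv.sumPiEquivProdPi fun _ : SymmCoord m => ℝ) ⁻¹'
    ((c.extend ⁻¹' E ∩ c.dom) ×ˢ B)

lemma mem_coordPreimage {E : Set (Matrix.orthogonalGroup (Fin m) ℝ)} {B : Set (Fin m → ℝ)}
    {z : SymmCoord m → ℝ} : z ∈ c.coordPreimage E B ↔
      (fun p => z (.inl p)) ∈ c.dom ∧ c.toFun (fun p => z (.inl p)) ∈ E ∧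
        (fun i => z (.inr i)) ∈ B := by
  change (c.extend (fun p => z (.inl p)) ∈ E ∧ (fun p => z (.inl p)) ∈ c.dom) ∧
    (fun i => z (.inr i)) ∈ B ↔ _
  constructor
  · rintro ⟨⟨h1, h2⟩, h3⟩
    exact ⟨h2, c.extend_of_mem h2 ▸ h1, h3⟩
  · rintro ⟨h2, h1, h3⟩
    exact ⟨⟨(c.extend_of_mem h2).symm ▸ h1, h2⟩, h3⟩

lemma measurableSet_coordPreimage {E : Set (Matrix.orthogonalGroup (Fin m) ℝ)}
    (hE : MeasurableSet E) {B : Set (Fin m → ℝ)} (hB : MeasurableSet B) :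
    MeasurableSet (c.coordPreimage E B) :=
  (MeasurableEquiv.measurable _)
    (((c.measurable_extend hE).inter c.isOpen_dom.measurableSet).prod hB)

lemma injOn_coordMap {E : Set (Matrix.orthogonalGroup (Fin m) ℝ)} {B : Set (Fin m → ℝ)}
    (hinj : Set.InjOn conjDiag (E ×ˢ B)) : Set.InjOn c.coordMap (c.coordPreimage E B) := by
  intro z hz w hw h
  obtain ⟨hz1, hz2, hz3⟩ := c.mem_coordPreimage.1 hz
  obtain ⟨hw1, hw2, hw3⟩ := c.mem_coordPreimage.1 hw
  have h1 := congrArg (symmOfCoord m) h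
  rw [symmOfCoord_coordMap, symmOfCoord_coordMap] at h1
  have h2 := hinj ⟨hz2, hz3⟩ ⟨hw2, hw3⟩ h1
  have h3 := c.injOn hz1 hw1 (congrArg Prod.fst h2)
  have h4 := congrArg Prod.snd h2
  ext (p | i)
  · exact congrFun h3 p
  · exact congrFun h4 i

lemma symmOfCoord_preimage_image {E : Set (Matrix.orthogonalGroup (Fin m) ℝ)}
    (hEc : E ⊆ c.toFun '' c.dom) (B : Set (Fin m → ℝ)) :
    symmOfCoord m ⁻¹' (conjDiag '' (E ×ˢ B)) = c.coordMap '' c.coordPreimage E B := by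
  ext z
  constructor
  · rintro ⟨⟨H, x⟩, ⟨hH, hx⟩, h⟩
    obtain ⟨u, hu, rfl⟩ := hEc hH
    refine ⟨Sum.elim u x, c.mem_coordPreimage.2 ⟨hu, hH, hx⟩, ?_⟩
    rw [← coordOfMatrix_symmOfCoord z, ← h]
    rfl
  · rintro ⟨w, hw, rfl⟩
    obtain ⟨hw1, hw2, hw3⟩ := c.mem_coordPreimage.1 hw
    exact ⟨_, ⟨hw2, hw3⟩, (c.symmOfCoord_coordMap w).symm⟩

lemma setLIntegral_measure_prod {E : Set (Matrix.orthogonalGroup (Fin m) ℝ)}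
    (hE : MeasurableSet E) (B : Set (Fin m → ℝ))
    {W : Matrix.orthogonalGroup (Fin m) ℝ × (Fin m → ℝ) → ℝ≥0∞} (hW : Measurable W) :
    ∫⁻ H in E, (∫⁻ x in B, W (H, x)) ∂c.measure =
      ∫⁻ z in c.coordPreimage E B, c.density (fun p => z (.inl p)) *
        W (c.extend (fun p => z (.inl p)), fun i => z (.inr i)) := by
  rw [c.setLIntegral_measure hE hW.lintegral_prod_right']
  calc _ = ∫⁻ u in c.extend ⁻¹' E ∩ c.dom, ∫⁻ x in B, c.density u * W (c.extend u, x) :=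
        lintegral_congr fun u =>
          (lintegral_const_mul _ (hW.comp (measurable_prodMk_left (x := c.extend u)))).symm
    _ = ∫⁻ p in (c.extend ⁻¹' E ∩ c.dom) ×ˢ B, c.density p.1 * W (c.extend p.1, p.2) := by
        rw [Measure.volume_eq_prod, setLIntegral_prod]
        refine (Measurable.mul (c.measurable_density.comp measurable_fst) ?_).aemeasurable
        exact hW.comp ((c.measurable_extend.comp measurable_fst).prodMk measurable_snd)
    _ = _ :=
        ((volume_measurePreserving_sumPiEquivProdPi
          fun _ : SymmCoord m => ℝ).setLIntegral_comp_preimage_emb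
          (MeasurableEquiv.measurableEmbedding _)
          (fun p => c.density p.1 * W (c.extend p.1, p.2)) _).symm

/-- The change of variables formula for `(H, x) ↦ H diag(x) H'`, where `H` runs over a piece of a
parametrization on which the map is injective. -/
lemma setLIntegral_conjDiag {E : Set (Matrix.orthogonalGroup (Fin m) ℝ)} (hE : MeasurableSet E)
    (hEc : E ⊆ c.toFun '' c.dom) {B : Set (Fin m → ℝ)} (hB : MeasurableSet B)
    (hinj : Set.InjOn conjDiag (E ×ˢ B)) {T : Set (Matrix (Fin m) (Fin m) ℝ)}
    (hT : MeasurableSet T) :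
    ∫⁻ H in E, (∫⁻ x in B, ENNReal.ofReal |gapProd x| * T.indicator 1 (conjDiag (H, x)))
        ∂c.measure =
      symmLebesgue m (T ∩ conjDiag '' (E ×ˢ B)) := by
  have hTm := (measurableEmbedding_symmOfCoord m).measurable hT
  have hZm := c.measurableSet_coordPreimage hE hB
  rw [c.setLIntegral_measure_prod hE B (measurable_weight hT), symmLebesgue_eq_map,
    (measurableEmbedding_symmOfCoord m).map_apply, Set.preimage_inter,
    c.symmOfCoord_preimage_image hEc]
  calc _ = ∫⁻ z in c.coordPreimage E B, ENNReal.ofReal |(c.coordDeriv z).det| *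
        (symmOfCoord m ⁻¹' T).indicator 1 (c.coordMap z) := by
        refine setLIntegral_congr_fun hZm fun z hz => ?_
        have hd := (c.mem_coordPreimage.1 hz).1
        have hi : (symmOfCoord m ⁻¹' T).indicator (1 : (SymmCoord m → ℝ) → ℝ≥0∞) (c.coordMap z) =
            T.indicator 1 (symmOfCoord m (c.coordMap z)) := rfl
        simp only []
        rw [abs_det_coordDeriv, ENNReal.ofReal_mul (abs_nonneg _), density,
          Set.indicator_of_mem hd, c.extend_of_mem hd, hi, symmOfCoord_coordMap, ← mul_assoc,
          mul_comm (ENNReal.ofReal _)]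
    _ = ∫⁻ w in c.coordMap '' c.coordPreimage E B, (symmOfCoord m ⁻¹' T).indicator 1 w :=
        (lintegral_image_eq_lintegral_abs_det_fderiv_mul volume hZm
          (fun z hz => (c.hasFDerivAt_coordMap
            (c.mem_coordPreimage.1 hz).1).hasFDerivWithinAt) (c.injOn_coordMap hinj) _).symm
    _ = _ := by rw [lintegral_indicator_one hTm, Measure.restrict_apply hTm]

end OrthParam

lemma exists_compact_gap_box (m : ℕ) : ∃ B : Set (Fin m → ℝ), MeasurableSet B ∧
    B ⊆ {x | StrictAnti x} ∧ ∫⁻ x in B, ENNReal.ofReal |gapProd x| ≠ 0 ∧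
    ∫⁻ x in B, ENNReal.ofReal |gapProd x| ≠ ∞ := by
  have hx0 : (fun i : Fin m => -(i : ℝ)) ∈ {x : Fin m → ℝ | StrictAnti x} := by
    intro i j hij
    simpa using hij
  obtain ⟨r, hr, hsub⟩ := Metric.nhds_basis_closedBall.mem_iff.1
    ((isOpen_strictAnti m).mem_nhds hx0)
  refine ⟨_, Metric.isClosed_closedBall.measurableSet, hsub, ?_, ?_⟩
  · intro h
    rw [lintegral_eq_zero_iff (measurable_gapProd m).abs.ennreal_ofReal,
      Filter.EventuallyEq, ae_restrict_iff' Metric.isClosed_closedBall.measurableSet] at h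
    have hpos : ∀ x ∈ Metric.closedBall (fun i : Fin m => -(i : ℝ)) r,
        ENNReal.ofReal |gapProd x| ≠ 0 := by
      intro x hx
      have hg : 0 < gapProd x := Finset.prod_pos fun p _ => sub_pos.2 (hsub hx p.2)
      simpa using hg.ne'
    have h0 : ∀ᵐ x, x ∉ Metric.closedBall (fun i : Fin m => -(i : ℝ)) r := by
      filter_upwards [h] with x hx hxB using hpos x hxB (hx hxB)
    have := measure_eq_zero_iff_ae_notMem.2 h0
    exact (Metric.measure_closedBall_pos volume _ hr).ne' this
  · have hc : ContinuousOn (fun x : Fin m → ℝ => gapProd x)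
        (Metric.closedBall (fun i : Fin m => -(i : ℝ)) r) := by
      unfold gapProd; fun_prop
    have hi := (hc.integrableOn_compact (isCompact_closedBall _ _)
      (μ := volume)).hasFiniteIntegral
    simp only [HasFiniteIntegral, ← ofReal_norm, Real.norm_eq_abs] at hi
    exact hi.ne

lemma measure_eq_sum_signPiece {m : ℕ} (μ : Measure (Matrix.orthogonalGroup (Fin m) ℝ))
    (E : Set (Matrix.orthogonalGroup (Fin m) ℝ)) (hE : MeasurableSet E) :
    μ E = ∑ s, μ (E ∩ signPiece s) := by
  rw [← tsum_fintype (L := .unconditional _), ← measure_iUnion, ← Set.inter_iUnion,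
    iUnion_signPiece, Set.inter_univ]
  · exact fun s s' h => (pairwise_disjoint_signPiece m h).mono Set.inter_subset_right
      Set.inter_subset_right
  · exact fun s => hE.inter (measurableSet_signPiece s)

lemma OrthParam.measure_apply_eq {m : ℕ} (c c' : OrthParam m)
    {E : Set (Matrix.orthogonalGroup (Fin m) ℝ)} (hE : MeasurableSet E)
    (hc : E ⊆ c.toFun '' c.dom) (hc' : E ⊆ c'.toFun '' c'.dom) :
    c.measure E = c'.measure E := by
  obtain ⟨B, hB, hBs, h0, htop⟩ := exists_compact_gap_box m
  rw [measure_eq_sum_signPiece _ E hE, measure_eq_sum_signPiece _ E hE]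
  refine Finset.sum_congr rfl fun s _ => ?_
  have key (d : OrthParam m) (hd : E ⊆ d.toFun '' d.dom) :=
    d.setLIntegral_conjDiag (hE.inter (measurableSet_signPiece s))
      (Set.inter_subset_left.trans hd) hB
      ((injOn_conjDiag s).mono (Set.prod_mono Set.inter_subset_right hBs)) MeasurableSet.univ
  have h := (key c hc).trans (key c' hc').symm
  simp only [Set.indicator_univ, Pi.one_apply, mul_one, setLIntegral_const] at h
  exact (ENNReal.mul_right_inj h0 htop).1 h

lemma OrthParam.measure_image_compl {m : ℕ} (c : OrthParam m) :
    c.measure (c.toFun '' c.dom)ᶜ = 0 := by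
  have hm := c.measurableSet_image c.isOpen_dom.measurableSet subset_rfl
  have h := c.setLIntegral_measure hm.compl measurable_one
  simp only [Pi.one_apply, setLIntegral_one] at h
  rw [h]
  have : c.extend ⁻¹' (c.toFun '' c.dom)ᶜ ∩ c.dom = ∅ := by
    ext u
    simp only [Set.mem_inter_iff, Set.mem_preimage, Set.mem_compl_iff, Set.mem_empty_iff_false,
      iff_false, not_and]
    intro h1 hu
    rw [c.extend_of_mem hu] at h1
    exact h1 ⟨u, hu, rfl⟩
  rw [this]; simp

/-- The invariant measure is glued from any countable family of parametrizations that covers. -/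
lemma orthFormMeasure_eq_sum {m : ℕ} {c : ℕ → OrthParam m}
    (hc : ⋃ n, (c n).toFun '' (c n).dom = Set.univ) :
    orthFormMeasure m = Measure.sum fun n => (c n).measure.restrict
      (disjointed (fun n => (c n).toFun '' (c n).dom) n) := by
  set P := disjointed fun n => (c n).toFun '' (c n).dom with hP
  have hm (d : OrthParam m) := d.measurableSet_image d.isOpen_dom.measurableSet subset_rfl
  have hPm (n) : MeasurableSet (P n) := MeasurableSet.disjointed (fun n => hm (c n)) n
  have hPd : Pairwise (Function.onFun Disjoint P) := disjoint_disjointed _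
  have hPu : ⋃ n, P n = Set.univ := by rw [hP, iUnion_disjointed, hc]
  have hsplit (μ : Measure (Matrix.orthogonalGroup (Fin m) ℝ)) :
      μ = Measure.sum fun n => μ.restrict (P n) := by
    rw [← Measure.restrict_iUnion hPd hPm, hPu, Measure.restrict_univ]
  refine le_antisymm (iSup_le fun d => ?_) ?_
  · refine Measure.le_iff.2 fun E hE => ?_
    rw [hsplit d.measure, Measure.sum_apply _ hE, Measure.sum_apply _ hE]
    refine ENNReal.tsum_le_tsum fun n => ?_
    rw [Measure.restrict_apply hE, Measure.restrict_apply hE,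
      ← measure_inter_conull (d.measure_image_compl)]
    rw [d.measure_apply_eq (c n) ((hE.inter (hPm n)).inter (hm d)) Set.inter_subset_right
      ((Set.inter_subset_left.trans Set.inter_subset_right).trans (disjointed_subset _ n))]
    exact measure_mono Set.inter_subset_left
  · rw [hsplit (orthFormMeasure m)]
    refine Measure.le_iff.2 fun E hE => ?_
    rw [Measure.sum_apply _ hE, Measure.sum_apply _ hE]
    exact ENNReal.tsum_le_tsum fun n =>
      Measure.restrict_mono subset_rfl (le_iSup (fun c : OrthParam m => c.measure) (c n)) E

instance (m : ℕ) : SFinite (orthFormMeasure m) := by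
  obtain ⟨c, hc⟩ := exists_seq_orthParam_cover m
  rw [orthFormMeasure_eq_sum hc]
  infer_instance

lemma lintegral_conjDiag_orthFormMeasure {m : ℕ} {B : Set (Fin m → ℝ)} (hB : MeasurableSet B)
    (hBs : B ⊆ {x | StrictAnti x}) {T : Set (Matrix (Fin m) (Fin m) ℝ)} (hT : MeasurableSet T) :
    ∫⁻ H, (∫⁻ x in B, ENNReal.ofReal |gapProd x| * T.indicator 1 (conjDiag (H, x)))
        ∂orthFormMeasure m =
      2 ^ m * symmLebesgue m (T ∩ conjDiag '' (Set.univ ×ˢ B)) := by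
  obtain ⟨c, hc⟩ := exists_seq_orthParam_cover m
  have hm (n) := (c n).measurableSet_image (c n).isOpen_dom.measurableSet subset_rfl
  rw [orthFormMeasure_eq_sum hc, lintegral_sum_measure]
  set P := disjointed fun n => (c n).toFun '' (c n).dom with hP
  have hPm (n) : MeasurableSet (P n) := MeasurableSet.disjointed hm n
  have hPd : Pairwise (Function.onFun Disjoint P) := disjoint_disjointed _
  have hPu : ⋃ n, P n = Set.univ := by rw [hP, iUnion_disjointed, hc]
  have hinj (n : ℕ) (s : Fin m → ℤˣ) : Set.InjOn conjDiag ((P n ∩ signPiece s) ×ˢ B) :=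
    (injOn_conjDiag s).mono (Set.prod_mono Set.inter_subset_right hBs)
  have hpiece (n : ℕ) : ∫⁻ H in P n, (∫⁻ x in B,
      ENNReal.ofReal |gapProd x| * T.indicator 1 (conjDiag (H, x))) ∂(c n).measure =
      ∑ s, symmLebesgue m (T ∩ conjDiag '' ((P n ∩ signPiece s) ×ˢ B)) := by
    have h1 : P n = ⋃ s, P n ∩ signPiece s := by
      rw [← Set.inter_iUnion, iUnion_signPiece, Set.inter_univ]
    conv_lhs => rw [h1]
    rw [lintegral_iUnion (fun s => (hPm n).inter (measurableSet_signPiece s))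
      (fun s s' h => (pairwise_disjoint_signPiece m h).mono Set.inter_subset_right
        Set.inter_subset_right), tsum_fintype]
    refine Finset.sum_congr rfl fun s _ => ?_
    exact (c n).setLIntegral_conjDiag ((hPm n).inter (measurableSet_signPiece s))
      (Set.inter_subset_left.trans (disjointed_subset _ n)) hB (hinj n s) hT
  simp only [hpiece]
  rw [Summable.tsum_finsetSum fun _ _ => ENNReal.summable]
  have hs (s : Fin m → ℤˣ) :
      ∑' n, symmLebesgue m (T ∩ conjDiag '' ((P n ∩ signPiece s) ×ˢ B)) =
        symmLebesgue m (T ∩ conjDiag '' (Set.univ ×ˢ B)) := by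
    rw [← measure_iUnion, ← Set.inter_iUnion, ← Set.image_iUnion, ← Set.iUnion_prod_const,
      ← Set.iUnion_inter, hPu, Set.univ_inter, image_conjDiag_signPiece]
    · intro n n' h
      refine Disjoint.mono Set.inter_subset_right Set.inter_subset_right ?_
      refine Set.disjoint_image_image ?_
      rintro ⟨H, x⟩ ⟨⟨h1, h2⟩, h3⟩ ⟨H', x'⟩ ⟨⟨h1', h2'⟩, h3'⟩ heq
      have h4 := injOn_conjDiag s ⟨h2, hBs h3⟩ ⟨h2', hBs h3'⟩ heq
      obtain rfl : H = H' := congrArg Prod.fst h4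
      exact Set.disjoint_left.1 (hPd h) h1 h1'
    · intro n
      exact hT.inter ((((hPm n).inter (measurableSet_signPiece s)).prod hB).image_of_measurable_injOn
        (measurable_conjDiag m) (hinj n s))
  simp only [hs, Finset.sum_const, Finset.card_univ, nsmul_eq_mul]
  congr 1
  rw [Fintype.card_fun, Fintype.card_units_int, Fintype.card_fin]
  norm_num

/-- The diagonal `(l₁, …, l_{m₁}, -d₁, …, -d_{m₂})`. -/
def signedAppend {m₁ m₂ : ℕ} (p : (Fin m₁ → ℝ) × (Fin m₂ → ℝ)) : Fin (m₁ + m₂) → ℝ :=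
  Fin.append p.1 (fun j => -p.2 j)

lemma measurePreserving_signedAppend (m₁ m₂ : ℕ) :
    MeasurePreserving (signedAppend (m₁ := m₁) (m₂ := m₂)) := by
  have h1 : MeasurePreserving (Prod.map id Neg.neg :
      (Fin m₁ → ℝ) × (Fin m₂ → ℝ) → (Fin m₁ → ℝ) × (Fin m₂ → ℝ)) :=
    (MeasurePreserving.id volume).prod (Measure.measurePreserving_neg volume)
  have h2 := (volume_measurePreserving_sumPiEquivProdPi fun _ : Fin m₁ ⊕ Fin m₂ => ℝ).symm
  have h3 := volume_measurePreserving_piCongrLeft (fun _ : Fin (m₁ + m₂) => ℝ) finSumFinEquiv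
  have he : (signedAppend : (Fin m₁ → ℝ) × (Fin m₂ → ℝ) → _) =
      MeasurableEquiv.piCongrLeft (fun _ : Fin (m₁ + m₂) => ℝ) finSumFinEquiv ∘
        (MeasurableEquiv.sumPiEquivProdPi fun _ : Fin m₁ ⊕ Fin m₂ => ℝ).symm ∘
          Prod.map id Neg.neg := by
    ext p i
    refine Fin.addCases (fun i => ?_) (fun j => ?_) i
    · rw [signedAppend, Fin.append_left, ← finSumFinEquiv_apply_left]
      exact (Equiv.piCongrLeft_apply_apply (fun _ : Fin (m₁ + m₂) => ℝ) finSumFinEquiv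
        (Sum.elim p.1 fun j => -p.2 j) (.inl _)).symm
    · rw [signedAppend, Fin.append_right, ← finSumFinEquiv_apply_right]
      exact (Equiv.piCongrLeft_apply_apply (fun _ : Fin (m₁ + m₂) => ℝ) finSumFinEquiv
        (Sum.elim p.1 fun j => -p.2 j) (.inr _)).symm
  rw [he]
  exact h3.comp (h2.comp h1)

/-- The decreasing vectors with `m₁` positive entries followed by `m₂` negative ones. -/
def signedDecreasing (m₁ m₂ : ℕ) : Set (Fin (m₁ + m₂) → ℝ) :=
  {x | StrictAnti x ∧ (∀ i, 0 < x (Fin.castAdd m₂ i)) ∧ ∀ j, x (Fin.natAdd m₁ j) < 0}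

lemma measurableSet_signedDecreasing (m₁ m₂ : ℕ) : MeasurableSet (signedDecreasing m₁ m₂) := by
  have : signedDecreasing m₁ m₂ = {x | StrictAnti x} ∩
      ((⋂ i, {x | 0 < x (Fin.castAdd m₂ i)}) ∩ ⋂ j, {x | x (Fin.natAdd m₁ j) < 0}) := by
    ext x; simp [signedDecreasing]
  rw [this]
  refine (isOpen_strictAnti _).measurableSet.inter (MeasurableSet.inter ?_ ?_)
  · exact .iInter fun i => measurableSet_lt measurable_const (measurable_pi_apply _)
  · exact .iInter fun i => measurableSet_lt (measurable_pi_apply _) measurable_const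

lemma preimage_signedDecreasing (m₁ m₂ : ℕ) :
    signedAppend ⁻¹' signedDecreasing m₁ m₂ = eigenDomain m₁ m₂ := by
  ext ⟨l, d⟩
  simp only [signedDecreasing, signedAppend, eigenDomain, Set.mem_preimage, Set.mem_ofPred_eq,
    Fin.append_left, Fin.append_right]
  constructor
  · rintro ⟨h1, h2, h3⟩
    refine ⟨⟨fun i j hij => ?_, h2⟩, fun i j hij => ?_, h3⟩
    · simpa using h1 (show Fin.castAdd m₂ i < Fin.castAdd m₂ j from hij)
    · simpa using h1 (show Fin.natAdd m₁ i < Fin.natAdd m₁ j by simpa using hij)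
  · rintro ⟨⟨h1, h2⟩, h3, h4⟩
    refine ⟨fun i j => ?_, h2, h4⟩
    refine Fin.addCases (fun i => ?_) (fun i => ?_) i <;>
      refine Fin.addCases (fun j => ?_) (fun j => ?_) j <;> intro hij
    · simpa using h1 (show i < j from hij)
    · simpa using (h4 j).trans (h2 i)
    · simp [Fin.lt_def] at hij; omega
    · simpa using h3 (show i < j by simpa using hij)

lemma prod_Ioi_eq_prod_ite {n : ℕ} (f : Fin n → Fin n → ℝ) :
    ∏ i, ∏ j ∈ Finset.Ioi i, f i j = ∏ i, ∏ j, if i < j then f i j else 1 := by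
  refine Finset.prod_congr rfl fun i _ => ?_
  rw [← Finset.prod_filter]
  congr 1
  ext j; simp

lemma abs_eigenJacobian {m₁ m₂ : ℕ} (p : (Fin m₁ → ℝ) × (Fin m₂ → ℝ)) :
    |eigenJacobian p| = |gapProd (signedAppend p)| := by
  rw [gapProd, prod_strictPairs (fun i j => signedAppend p i - signedAppend p j), eigenJacobian,
    prod_Ioi_eq_prod_ite, prod_Ioi_eq_prod_ite, Fin.prod_univ_add]
  simp only [Fin.prod_univ_add, signedAppend, Fin.append_left, Fin.append_right,
    Finset.prod_mul_distrib, Finset.abs_prod, abs_mul]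
  have h1 (i : Fin m₁) (j : Fin m₂) : Fin.castAdd m₂ i < Fin.natAdd m₁ j := by
    simp [Fin.lt_def]; omega
  have h2 (i j : Fin m₁) : Fin.castAdd m₂ i < Fin.castAdd m₂ j ↔ i < j := Iff.rfl
  have h3 (i j : Fin m₂) : Fin.natAdd m₁ i < Fin.natAdd m₁ j ↔ i < j := by simp
  simp only [h1, h2, h3, (h1 _ _).not_gt, if_true, if_false, abs_one, Finset.prod_const_one,
    one_mul, sub_neg_eq_add, apply_ite abs, neg_add_eq_sub]
  have h4 (i j : Fin m₂) : |p.2 j - p.2 i| = |p.2 i - p.2 j| := abs_sub_comm _ _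
  simp only [h4]
  ring

lemma hasEigenvalue_conjDiag {m : ℕ} (H : Matrix.orthogonalGroup (Fin m) ℝ) (x : Fin m → ℝ)
    (r : ℝ) : Module.End.HasEigenvalue (Matrix.toLin' (conjDiag (H, x))) r ↔ r ∈ Set.range x := by
  rw [Module.End.hasEigenvalue_iff_mem_spectrum, Matrix.spectrum_toLin']
  have h := spectrum.units_conjugate (R := ℝ) (a := Matrix.diagonal x)
    (u := ⟨(H : Matrix (Fin m) (Fin m) ℝ), (H : Matrix (Fin m) (Fin m) ℝ).transpose,
      orthogonal_mul_transpose H, orthogonal_transpose_mul H⟩)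
  rw [← spectrum_diagonal x, ← h]
  rfl

lemma ncard_eigenvalues_conjDiag {m : ℕ} (H : Matrix.orthogonalGroup (Fin m) ℝ) {x : Fin m → ℝ}
    (hx : Function.Injective x) (p : ℝ → Prop) :
    {r : ℝ | p r ∧ Module.End.HasEigenvalue (Matrix.toLin' (conjDiag (H, x))) r}.ncard =
      {i | p (x i)}.ncard := by
  rw [← Set.ncard_image_of_injective _ hx]
  congr 1
  ext r
  simp only [hasEigenvalue_conjDiag, Set.mem_ofPred_eq, Set.mem_image, Set.mem_range]
  constructor
  · rintro ⟨h, i, rfl⟩; exact ⟨i, h, rfl⟩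
  · rintro ⟨i, h, rfl⟩; exact ⟨h, i, rfl⟩

/-- Permuting the columns of an orthogonal matrix. -/
def permColumns {m : ℕ} (H : Matrix.orthogonalGroup (Fin m) ℝ) (s : Equiv.Perm (Fin m)) :
    Matrix.orthogonalGroup (Fin m) ℝ :=
  ⟨(H : Matrix (Fin m) (Fin m) ℝ).submatrix id s, by
    rw [Matrix.mem_orthogonalGroup_iff]
    change _ * ((H : Matrix (Fin m) (Fin m) ℝ).transpose).submatrix s id = 1
    rw [Matrix.submatrix_mul_equiv, orthogonal_mul_transpose, Matrix.submatrix_id_id]⟩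

lemma conjDiag_permColumns {m : ℕ} (H : Matrix.orthogonalGroup (Fin m) ℝ)
    (s : Equiv.Perm (Fin m)) (x : Fin m → ℝ) :
    conjDiag (permColumns H s, x ∘ s) = conjDiag (H, x) := by
  ext a b
  rw [conjDiag_apply, conjDiag_apply]
  exact Equiv.sum_comp s fun k => (H : Matrix (Fin m) (Fin m) ℝ) a k * x k *
    (H : Matrix (Fin m) (Fin m) ℝ) b k

lemma exists_conjDiag_eq {m : ℕ} {A : Matrix (Fin m) (Fin m) ℝ} (hA : A.IsSymm) :
    ∃ H x, Antitone x ∧ conjDiag (H, x) = A := by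
  have hH : A.IsHermitian := by
    rw [Matrix.IsHermitian, Matrix.conjTranspose_eq_transpose_of_trivial]; exact hA
  have h := hH.spectral_theorem
  rw [Unitary.conjStarAlgAut_apply] at h
  have h' : conjDiag (hH.eigenvectorUnitary, hH.eigenvalues) = A := h.symm
  refine ⟨permColumns hH.eigenvectorUnitary (Tuple.sort fun i => -hH.eigenvalues i),
    hH.eigenvalues ∘ Tuple.sort fun i => -hH.eigenvalues i, fun i j hij => ?_,
    (conjDiag_permColumns _ _ _).trans h'⟩
  exact neg_le_neg_iff.1 (Tuple.monotone_sort (fun i => -hH.eigenvalues i) hij)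

lemma symmIndef_eq_image (m₁ m₂ : ℕ) :
    symmIndef m₁ m₂ = conjDiag '' (Set.univ ×ˢ signedDecreasing m₁ m₂) := by
  ext A
  constructor
  · rintro ⟨hA, h1, h2⟩
    obtain ⟨H, x, hx, rfl⟩ := exists_conjDiag_eq hA
    have hinj : Function.Injective x := by
      have hsub : {r : ℝ | 0 < r ∧ Module.End.HasEigenvalue (Matrix.toLin' (conjDiag (H, x))) r} ∪
          {r : ℝ | r < 0 ∧ Module.End.HasEigenvalue (Matrix.toLin' (conjDiag (H, x))) r} ⊆
          Set.range x := by
        rintro r (⟨-, h⟩ | ⟨-, h⟩) <;> exact (hasEigenvalue_conjDiag H x r).1 h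
      have hfin := Set.finite_range x
      have hcard := Set.ncard_le_ncard hsub hfin
      rw [Set.ncard_union_eq (Set.disjoint_left.2 fun r h h' => lt_asymm h.1 h'.1)
        (hfin.subset (Set.subset_union_left.trans hsub))
        (hfin.subset (Set.subset_union_right.trans hsub)), h1, h2] at hcard
      rw [← Set.injOn_univ, ← Set.ncard_image_iff, Set.image_univ]
      refine le_antisymm ?_ ?_
      · rw [← Set.image_univ]; exact Set.ncard_image_le
      · simpa [Set.ncard_univ] using hcard
    have hx' : StrictAnti x := hx.strictAnti_of_injective hinj
    rw [ncard_eigenvalues_conjDiag H hinj] at h1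
    rw [ncard_eigenvalues_conjDiag H hinj (fun r => r < 0)] at h2
    refine ⟨(H, x), ⟨Set.mem_univ _, hx', fun i => ?_, fun j => ?_⟩, rfl⟩
    · by_contra hneg
      have hsub : {k | 0 < x k} ⊆ ↑(Finset.Iio (Fin.castAdd m₂ i)) := fun k hk => by
        rw [Finset.coe_Iio, Set.mem_Iio]
        by_contra hle
        exact hneg (lt_of_lt_of_le hk (hx (not_lt.1 hle)))
      have := Set.ncard_le_ncard hsub (Finset.finite_toSet _)
      rw [h1, Set.ncard_coe_finset, Fin.card_Iio] at this
      simp at this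
      omega
    · by_contra hneg
      have hsub : {k | x k < 0} ⊆ ↑(Finset.Ioi (Fin.natAdd m₁ j)) := fun k hk => by
        rw [Finset.coe_Ioi, Set.mem_Ioi]
        by_contra hle
        exact hneg (lt_of_le_of_lt (hx (not_lt.1 hle)) hk)
      have := Set.ncard_le_ncard hsub (Finset.finite_toSet _)
      rw [h2, Set.ncard_coe_finset, Fin.card_Ioi] at this
      simp at this
      omega
  · rintro ⟨⟨H, x⟩, ⟨-, hx, hpos, hneg⟩, rfl⟩
    refine ⟨isSymm_conjDiag _, ?_, ?_⟩
    · rw [ncard_eigenvalues_conjDiag H hx.injective]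
      have : {i | 0 < x i} = Set.range (Fin.castAdd m₂) := by
        ext i
        refine Fin.addCases (fun i => ?_) (fun j => ?_) i
        · simpa using hpos i
        · refine iff_of_false (not_lt.2 (hneg j).le) ?_
          rintro ⟨k, hk⟩
          simp [Fin.ext_iff] at hk
          omega
      rw [this, ← Set.image_univ, Set.ncard_image_of_injective _ (Fin.castAdd_injective _ _)]
      simp [Set.ncard_univ]
    · rw [ncard_eigenvalues_conjDiag H hx.injective (fun r => r < 0)]
      have : {i | x i < 0} = Set.range (Fin.natAdd m₁) := by
        ext i
        refine Fin.addCases (fun i => ?_) (fun j => ?_) i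
        · refine iff_of_false (not_lt.2 (hpos i).le) ?_
          rintro ⟨k, hk⟩
          simp [Fin.ext_iff] at hk
          omega
        · simpa using hneg j
      rw [this, ← Set.image_univ, Set.ncard_image_of_injective _ (Fin.natAdd_injective _ _)]
      simp [Set.ncard_univ]

lemma spectralMap_eq {m₁ m₂ : ℕ}
    (q : Matrix.orthogonalGroup (Fin (m₁ + m₂)) ℝ × ((Fin m₁ → ℝ) × (Fin m₂ → ℝ))) :
    spectralMap q = conjDiag (q.1, signedAppend q.2) := rfl

lemma measurable_prod_signedAppend {X : Type*} [MeasurableSpace X] (m₁ m₂ : ℕ) :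
    Measurable fun q : X × ((Fin m₁ → ℝ) × (Fin m₂ → ℝ)) => (q.1, signedAppend q.2) :=
  measurable_fst.prodMk ((measurePreserving_signedAppend m₁ m₂).measurable.comp measurable_snd)

lemma measurable_spectralMap (m₁ m₂ : ℕ) : Measurable (spectralMap (m₁ := m₁) (m₂ := m₂)) := by
  rw [funext (spectralMap_eq (m₁ := m₁) (m₂ := m₂))]
  exact Measurable.comp (measurable_conjDiag (m₁ + m₂)) (measurable_prod_signedAppend m₁ m₂)

lemma lintegral_prod_eigenMeasure {X : Type*} [MeasurableSpace X] (μ : Measure X) {m₁ m₂ : ℕ}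
    {W : X × (Fin (m₁ + m₂) → ℝ) → ℝ≥0∞} (hW : Measurable W) :
    ∫⁻ q, W (q.1, signedAppend q.2) ∂(μ.prod (eigenMeasure m₁ m₂)) =
      ∫⁻ y, (∫⁻ x in signedDecreasing m₁ m₂, W (y, x)) ∂μ := by
  have hinst : SFinite (eigenMeasure m₁ m₂) := by unfold eigenMeasure; infer_instance
  have hm : Measurable fun q : X × ((Fin m₁ → ℝ) × (Fin m₂ → ℝ)) => W (q.1, signedAppend q.2) :=
    hW.comp (measurable_prod_signedAppend m₁ m₂)
  rw [lintegral_prod _ hm.aemeasurable]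
  refine lintegral_congr fun y => ?_
  rw [eigenMeasure, ← preimage_signedDecreasing]
  exact (measurePreserving_signedAppend m₁ m₂).setLIntegral_comp_preimage
    (measurableSet_signedDecreasing m₁ m₂) (f := fun x => W (y, x))
    (hW.comp (measurable_prodMk_left (x := y)))

/-- `(dA) = 2^{-m} |∏ (l_i - l_j) ∏ (d_i - d_j) ∏ (l_i + d_j)| (H'dH) ∧ (dD)` under `A = H D H'`:
on the symmetric matrices with `m₁` distinct positive and `m₂` distinct negative eigenvalues,
Lebesgue measure is the image of the measure on the right under `(H, D) ↦ H D H'`. -/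
theorem theorem1 (m₁ m₂ : ℕ) :
    (symmLebesgue (m₁ + m₂)).restrict (symmIndef m₁ m₂) =
      ((2 : ℝ≥0∞) ^ (m₁ + m₂))⁻¹ •
        (((orthFormMeasure (m₁ + m₂)).prod (eigenMeasure m₁ m₂)).withDensity
          (fun q => ENNReal.ofReal |eigenJacobian q.2|)).map spectralMap := by
  have hmap := measurable_spectralMap m₁ m₂
  ext T hT
  have key : (((orthFormMeasure (m₁ + m₂)).prod (eigenMeasure m₁ m₂)).withDensity
      (fun q => ENNReal.ofReal |eigenJacobian q.2|)).map spectralMap T =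
      2 ^ (m₁ + m₂) * symmLebesgue (m₁ + m₂) (T ∩ symmIndef m₁ m₂) := by
    rw [symmIndef_eq_image, ← lintegral_conjDiag_orthFormMeasure
      (measurableSet_signedDecreasing m₁ m₂) (fun x hx => hx.1) hT,
      ← lintegral_prod_eigenMeasure _ (OrthParam.measurable_weight hT),
      Measure.map_apply hmap hT, withDensity_apply _ (hmap hT), ← lintegral_indicator (hmap hT)]
    refine lintegral_congr fun q => ?_
    rw [← spectralMap_eq]
    by_cases hq : spectralMap q ∈ T
    · rw [Set.indicator_of_mem hq, Set.indicator_of_mem (show q ∈ spectralMap ⁻¹' T from hq),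
        abs_eigenJacobian, Pi.one_apply, mul_one]
    · rw [Set.indicator_of_notMem hq,
        Set.indicator_of_notMem (show q ∉ spectralMap ⁻¹' T from hq), mul_zero]
  rw [Measure.smul_apply, key, smul_eq_mul, ← mul_assoc, ENNReal.inv_mul_cancel (by simp)
    (by finiteness), one_mul, Measure.restrict_apply hT]
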